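/- All rings are associative with $1$, $J(R)$ is the Jacobson radical, $\mathbb N=\{1,2,\dots\}$, $\mathbb N_0=\mathbb N\cup\{0\}$. For a ring $R$, $V^*(R)$ is the commutative monoid of isomorphism classes of countably generated projective right $R$-modules with addition induced by $\oplus$, and $V(R)\subseteq V^*(R)$ is the submonoid of classes of finitely generated modules. The trace ideal of a right module $P$ is $\mathrm{Tr}(P)=\sum_{f\in \mathrm{Hom}_R(P,R)}f(P)$, and $\mathcal T$ is the set of trace ideals of projective right $R$-modules. Let $R$ be semi-semiperfect: $R/J(R)$ is semisimple artinian, and for every simple right $R$-module $V$ there are $n_V\in\mathbb N$ and a finitely generated projective right $R$-module $P$ with $P/PJ(R)\cong V^{n_V}$. Then $R$ has only finitely many simple right modules up to isomorphism; let $V_1,\dots,V_k$ be an ordered set of representatives of their isomorphism classes. For a countably generated projective right $R$-module $P$ with $P/PJ(R)\cong V_1^{(I_1)}\oplus\cdots\oplus V_k^{(I_k)}$ let $\dim(P)=(m_1,\dots,m_k)\in(\mathbb N_0\cup\{\infty\})^k$, where $m_i=|I_i|$ if $I_i$ is finite and $m_i=\infty$ otherwise. For $\mathbf x\in(\mathbb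 N_0\cup\{\infty\})^k$ let $\mathrm{supp}(\mathbf x)=\{i: x_i\ne 0\}$ and $\text{inf-supp}(\mathbf x)=\{i: x_i=\infty\}$. For $I\in\mathcal T$ let $\Phi(I)=\mathrm{supp}(\dim (P))$, where $P$ is any countably generated projective right $R$-module with $\mathrm{Tr}(P)=I$. **Theorem 4.5.** The map $\Phi$ is a bijection from $\mathcal T$ onto the set of subsets of $\{1,\dots,k\}$. There are finitely generated projective right $R$-modules $P_1,\dots,P_k$ with $\Phi(\mathrm{Tr}(P_i))=\{i\}$ for all $i$, and for every $J\in\mathcal T$ there is a finite set $G_J$ of countably generated projective right $R$-modules such that the classes of the modules $Q/QJ$, $Q\in G_J$, generate the monoid $V(R/J)$. For every choice of such $P_1,\dots,P_k$ and $(G_J)_{J\in\mathcal T}$ the following hold. 1. Let $P$ be a countably generated projective right $R$-module, let $X=\text{inf-supp}(\dim(P))$, and let $I\in\mathcal T$ be such that $\Phi(I)=X$. Then there are $n_Q\in\mathbb N_0$ $(Q\in G_I)$ with $$P\;\cong\;\Bigl(\bigoplus_{i\in X}P_i^{(\omega)}\Bigr)\oplus\Bigl(\bigoplus_{Q\in G_I}Q^{n_Q}\Bigr).$$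 2. The monoid $V^*(R)$ is generated by the finite set consisting of the classes of $P_1^{(\omega)},\dots,P_k^{(\omega)}$ and of the modules in $\bigcup_{J\in\mathcal T}G_J$. In particular, $V^*(R)$ is a finitely generated monoid. -/

import Mathlib

open scoped DirectSum

universe u

/-! Conventions. Modules over a ring `A` are left `A`-modules; right modules over a ring `R` are,
as in Mathlib, modules over `A = Rᵐᵒᵖ`. A two-sided ideal of `Rᵐᵒᵖ` is the same thing as a
two-sided ideal of `R`, and `Rᵐᵒᵖ ⧸ J`-modules are right `R ⧸ J`-modules. The Jacobson radical of
a ring is `Ring.jacobson`; it is left-right symmetric. For an ideal `J`, the submodule generated by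
the products of elements of `J` and elements of the module `P` is `J • (⊤ : Submodule A P)`. -/

namespace SemiSemi

/-- A countably generated projective module over `A`. -/
structure CGProj (A : Type u) [Ring A] where
  /-- the underlying module -/
  carrier : Type u
  [grp : AddCommGroup carrier]
  [mod : Module A carrier]
  [proj : Module.Projective A carrier]
  countablyGenerated : ∃ s : Set carrier, s.Countable ∧ Submodule.span A s = ⊤

namespace CGProj

instance (A : Type u) [Ring A] : CoeSort (CGProj A) (Type u) := ⟨carrier⟩

attribute [instance] grp mod proj

variable {A : Type u} [Ring A]

/-- The zero module. -/
def zero (A : Type u) [Ring A] : CGProj A where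
  carrier := PUnit.{u + 1}
  countablyGenerated := ⟨∅, Set.countable_empty, Subsingleton.elim _ _⟩

/-- The direct sum of two modules. -/
def add (P Q : CGProj A) : CGProj A where
  carrier := P × Q
  countablyGenerated := by
    obtain ⟨s, hs, hs'⟩ := P.countablyGenerated
    obtain ⟨t, ht, ht'⟩ := Q.countablyGenerated
    refine ⟨LinearMap.inl A P Q '' s ∪ LinearMap.inr A P Q '' t,
      (hs.image _).union (ht.image _), ?_⟩
    rw [Submodule.span_union, Submodule.span_image, Submodule.span_image, hs', ht',
      Submodule.map_top, Submodule.map_top]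
    exact LinearMap.sup_range_inl_inr

/-- The direct sum `P^(ω)` of countably infinitely many copies of `P`. -/
noncomputable def omega (P : CGProj A) : CGProj A where
  carrier := ⨁ _ : ℕ, P
  countablyGenerated := by
    classical
    obtain ⟨s, hs, hs'⟩ := P.countablyGenerated
    refine ⟨⋃ n : ℕ, DirectSum.lof A ℕ (fun _ => (P : Type u)) n '' s,
      Set.countable_iUnion fun n => hs.image _, ?_⟩
    rw [Submodule.span_iUnion]
    simp_rw [Submodule.span_image, hs', Submodule.map_top]
    exact DFinsupp.iSup_range_lsingle

theorem mk_smul_finsupp {X : Type u} (J : Ideal A) [J.IsTwoSided] (r : A) (x : X →₀ A ⧸ J) :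
    Ideal.Quotient.mk J r • x = r • x := rfl

theorem projective_quotient (P : Type u) [AddCommGroup P] [Module A P] [Module.Projective A P]
    (J : Ideal A) [J.IsTwoSided] :
    Module.Projective (A ⧸ J) (P ⧸ (J • ⊤ : Submodule A P)) := by
  refine Module.Projective.of_lifting_property'' fun f hf => ?_
  let f' : ((P ⧸ (J • ⊤ : Submodule A P)) →₀ A ⧸ J) →ₗ[A] (P ⧸ (J • ⊤ : Submodule A P)) :=
    { toFun := f
      map_add' := f.map_add
      map_smul' := fun r x => f.map_smul (Ideal.Quotient.mk J r) x }
  obtain ⟨g, hg⟩ := Module.projective_lifting_property f' (J • ⊤ : Submodule A P).mkQ hf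
  have hker : (J • ⊤ : Submodule A P) ≤ LinearMap.ker g := by
    rw [Submodule.smul_le]
    intro r hr n _
    rw [LinearMap.mem_ker, map_smul, ← mk_smul_finsupp, Ideal.Quotient.eq_zero_iff_mem.mpr hr,
      zero_smul]
  let h := (J • ⊤ : Submodule A P).liftQ g hker
  have hsmul : ∀ (r : A ⧸ J) (x : P ⧸ (J • ⊤ : Submodule A P)), h (r • x) = r • h x := by
    intro r x
    obtain ⟨r, rfl⟩ := Ideal.Quotient.mk_surjective r
    obtain ⟨x, rfl⟩ := Submodule.Quotient.mk_surjective _ x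
    rw [mk_smul_finsupp]
    exact h.map_smul r (Submodule.Quotient.mk x)
  refine ⟨{ toFun := h, map_add' := h.map_add, map_smul' := hsmul }, ?_⟩
  refine LinearMap.ext fun x => ?_
  obtain ⟨x, rfl⟩ := Submodule.Quotient.mk_surjective _ x
  exact LinearMap.congr_fun hg x

/-- `P ⧸ JP` as a module over `A ⧸ J`, for a two-sided ideal `J`. -/
def modIdeal (P : CGProj A) (J : Ideal A) [J.IsTwoSided] : CGProj (A ⧸ J) where
  carrier := P ⧸ (J • ⊤ : Submodule A P)
  proj := projective_quotient P J
  countablyGenerated := by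
    obtain ⟨s, hs, hs'⟩ := P.countablyGenerated
    refine ⟨(J • ⊤ : Submodule A P).mkQ '' s, hs.image _, (Submodule.eq_top_iff').mpr fun x => ?_⟩
    obtain ⟨x, rfl⟩ := Submodule.Quotient.mk_surjective _ x
    have hx : x ∈ Submodule.span A s := hs' ▸ Submodule.mem_top
    induction hx using Submodule.span_induction with
    | mem x hx => exact Submodule.subset_span ⟨x, hx, rfl⟩
    | zero => exact Submodule.zero_mem _
    | add x y _ _ hx hy => exact Submodule.add_mem _ hx hy
    | smul r x _ hx => exact Submodule.smul_mem _ (Ideal.Quotient.mk J r) hx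

end CGProj

/-- Two modules are equivalent when they are isomorphic. -/
instance isoSetoid (A : Type u) [Ring A] : Setoid (CGProj A) where
  r P Q := Nonempty (P ≃ₗ[A] Q)
  iseqv := ⟨fun _ => ⟨.refl _ _⟩, fun ⟨e⟩ => ⟨e.symm⟩, fun ⟨e⟩ ⟨f⟩ => ⟨e.trans f⟩⟩

/-- The monoid `V*(A)` of isomorphism classes of countably generated projective modules. -/
def VStar (A : Type u) [Ring A] : Type (u + 1) := Quotient (isoSetoid A)

/-- The isomorphism class of a countably generated projective module. -/
def cls {A : Type u} [Ring A] (P : CGProj A) : VStar A := Quotient.mk _ P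

instance (A : Type u) [Ring A] : Zero (VStar A) := ⟨cls (CGProj.zero A)⟩

instance (A : Type u) [Ring A] : Add (VStar A) :=
  ⟨Quotient.map₂ CGProj.add fun _ _ ⟨e⟩ _ _ ⟨f⟩ => ⟨e.prodCongr f⟩⟩

/-- `V*(A)` is a commutative monoid under direct sums. -/
instance (A : Type u) [Ring A] : AddCommMonoid (VStar A) where
  add_assoc := by
    rintro ⟨P⟩ ⟨Q⟩ ⟨N⟩
    exact Quotient.sound ⟨LinearEquiv.prodAssoc A P Q N⟩
  zero_add := by
    rintro ⟨P⟩
    exact Quotient.sound ⟨LinearEquiv.uniqueProd (M := P) (M₂ := PUnit.{u + 1})⟩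
  add_zero := by
    rintro ⟨P⟩
    exact Quotient.sound ⟨LinearEquiv.prodUnique (M := P) (M₂ := PUnit.{u + 1})⟩
  add_comm := by
    rintro ⟨P⟩ ⟨Q⟩
    exact Quotient.sound ⟨LinearEquiv.prodComm A P Q⟩
  nsmul := nsmulRec

theorem zero_def (A : Type u) [Ring A] : (0 : VStar A) = cls (CGProj.zero A) := rfl

theorem cls_add {A : Type u} [Ring A] (P Q : CGProj A) : cls P + cls Q = cls (P.add Q) := rfl

/-- The monoid `V(A)` of isomorphism classes of finitely generated projective modules, inside
`V*(A)`. -/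
def V (A : Type u) [Ring A] : AddSubmonoid (VStar A) where
  carrier := {x | ∃ P : CGProj A, Module.Finite A P ∧ cls P = x}
  zero_mem' := ⟨CGProj.zero A, inferInstanceAs (Module.Finite A PUnit.{u + 1}), rfl⟩
  add_mem' := by
    rintro _ _ ⟨P, hP, rfl⟩ ⟨Q, hQ, rfl⟩
    exact ⟨P.add Q, inferInstanceAs (Module.Finite A (P × Q)), rfl⟩

/-- The trace ideal of a module: the sum of the images of all homomorphisms to the ring. -/
def traceIdeal (A : Type u) [Ring A] (P : Type u) [AddCommGroup P] [Module A P] : Ideal A :=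
  ⨆ f : P →ₗ[A] A, LinearMap.range f

/-- The trace ideal is two-sided. -/
instance (A : Type u) [Ring A] (P : Type u) [AddCommGroup P] [Module A P] :
    (traceIdeal A P).IsTwoSided where
  mul_mem_of_left {a} b ha := by
    have h : traceIdeal A P ≤
        Submodule.comap (LinearMap.toSpanSingleton A A b) (traceIdeal A P) := by
      refine iSup_le fun f => ?_
      rintro _ ⟨p, rfl⟩
      exact Submodule.mem_iSup_of_mem ((LinearMap.toSpanSingleton A A b).comp f)
        (LinearMap.mem_range_self ((LinearMap.toSpanSingleton A A b).comp f) p)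
    exact h ha

/-- The set `𝒯` of the trace ideals of all projective modules. -/
def traceIdeals (A : Type u) [Ring A] : Set (Ideal A) :=
  {I | ∃ (P : Type u) (_ : AddCommGroup P) (_ : Module A P),
    Module.Projective A P ∧ traceIdeal A P = I}

/-- `R` is semi-semiperfect: `R ⧸ J(R)` is semisimple artinian, and for every simple right
`R`-module `S` there are `n ≥ 1` and a finitely generated projective right `R`-module `P` with
`P ⧸ P J(R) ≅ S ^ n`. -/
structure IsSemiSemiperfect (R : Type u) [Ring R] : Prop where
  semilocal : IsSemisimpleRing (R ⧸ Ring.jacobson R)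
  exists_projective : ∀ (S : Type u) [AddCommGroup S] [Module Rᵐᵒᵖ S], IsSimpleModule Rᵐᵒᵖ S →
    ∃ n : ℕ, 1 ≤ n ∧ ∃ P : CGProj Rᵐᵒᵖ, Module.Finite Rᵐᵒᵖ P ∧
      Nonempty ((P ⧸ (Ring.jacobson Rᵐᵒᵖ • ⊤ : Submodule Rᵐᵒᵖ P)) ≃ₗ[Rᵐᵒᵖ] (Fin n → S))

/-- A finite list of representatives of the isomorphism classes of simple `A`-modules, each class
occurring exactly once. -/
structure SimpleReps (A : Type u) [Ring A] (k : ℕ) where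
  /-- the `i`-th simple module -/
  simple : Fin k → Type u
  [grp : ∀ i, AddCommGroup (simple i)]
  [mod : ∀ i, Module A (simple i)]
  isSimple : ∀ i, IsSimpleModule A (simple i)
  eq_of_iso : ∀ i j, Nonempty (simple i ≃ₗ[A] simple j) → i = j
  exists_iso : ∀ (S : Type u) [AddCommGroup S] [Module A S], IsSimpleModule A S →
    ∃ i, Nonempty (S ≃ₗ[A] simple i)

attribute [instance] SimpleReps.grp SimpleReps.mod SimpleReps.isSimple

section dim

variable {A : Type u} [Ring A] {k : ℕ} (W : SimpleReps A k)

/-- The dimension vector of `P`: its `i`-th entry is the number of copies (in `ℕ ∪ {∞}`) of the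
`i`-th simple module in `P ⧸ J(A) P`, that is, the length of the corresponding isotypic component;
see `dim_eq_card`. -/
noncomputable def dim (P : Type u) [AddCommGroup P] [Module A P] (i : Fin k) : ℕ∞ :=
  Module.length A
    (isotypicComponent A (P ⧸ (Ring.jacobson A • ⊤ : Submodule A P)) (W.simple i))

theorem length_isotypicComponent (M : Type u) [AddCommGroup M] [Module A M] (I : Fin k → Type u)
    (e : M ≃ₗ[A] ⨁ i, ⨁ _ : I i, W.simple i) (i : Fin k) :
    Module.length A (isotypicComponent A M (W.simple i)) = ENat.card (I i) := by
  classical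
  have hc : isotypicComponent A M (W.simple i) =
      Submodule.comap e.toLinearMap
        (LinearMap.range (DirectSum.lof A (Fin k) (fun i => ⨁ _ : I i, W.simple i) i)) := by
    apply le_antisymm
    · refine sSup_le fun m hm x hx => ?_
      obtain ⟨em⟩ : Nonempty (m ≃ₗ[A] W.simple i) := hm
      refine ⟨e x i, ?_⟩
      apply DFinsupp.ext
      intro j
      by_cases hj : j = i
      · subst hj
        simp [DirectSum.lof_eq_of]
      · rw [DirectSum.lof_eq_of, DirectSum.of_eq_of_ne _ _ _ hj]
        apply Eq.symm
        apply DFinsupp.ext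
        intro a
        have : IsSimpleModule A m := .congr em
        let g : m →ₗ[A] W.simple j := DirectSum.component A (I j) (fun _ => W.simple j) a ∘ₗ
          DirectSum.component A (Fin k) (fun i => ⨁ _ : I i, W.simple i) j ∘ₗ
            e.toLinearMap ∘ₗ m.subtype
        rcases g.bijective_or_eq_zero with hg | hg
        · exact absurd (W.eq_of_iso j i ⟨(LinearEquiv.ofBijective g hg).symm.trans em⟩) hj
        · exact LinearMap.congr_fun hg ⟨x, hx⟩
    · intro x hx
      obtain ⟨y, hy⟩ := hx
      have hx' : x = e.symm (DirectSum.lof A (Fin k) (fun i => ⨁ _ : I i, W.simple i) i y) := by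
        rw [hy]
        exact (e.symm_apply_apply x).symm
      rw [hx']
      clear hx' hy
      induction y using DirectSum.induction_on with
      | zero => simp
      | add y z hy hz => rw [map_add, map_add]; exact Submodule.add_mem _ hy hz
      | of a y =>
        let g : W.simple i →ₗ[A] M := e.symm.toLinearMap ∘ₗ
          DirectSum.lof A (Fin k) (fun i => ⨁ _ : I i, W.simple i) i ∘ₗ
            DirectSum.lof A (I i) (fun _ => W.simple i) a
        have hg : Function.Injective g := e.symm.injective.comp
          ((DirectSum.of_injective i).comp (DirectSum.of_injective a))
        have hle : LinearMap.range g ≤ isotypicComponent A M (W.simple i) :=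
          le_sSup ⟨(LinearEquiv.ofInjective g hg).symm⟩
        exact hle (LinearMap.mem_range_self g y)
  have h1 : Module.length A (isotypicComponent A M (W.simple i)) =
      Module.length A (I i →₀ W.simple i) := by
    rw [hc]
    let N := LinearMap.range (DirectSum.lof A (Fin k) (fun i => ⨁ _ : I i, W.simple i) i)
    let e₁ : Submodule.comap e.toLinearMap N ≃ₗ[A] N :=
      (e.submoduleMap (Submodule.comap e.toLinearMap N)).trans
        (LinearEquiv.ofEq _ _ (Submodule.map_comap_eq_of_surjective e.surjective N))
    let e₂ : (⨁ _ : I i, W.simple i) ≃ₗ[A] N :=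
      LinearEquiv.ofInjective (DirectSum.lof A (Fin k) (fun i => ⨁ _ : I i, W.simple i) i)
        (DirectSum.of_injective i)
    exact ((e₁.trans e₂.symm).trans
      (finsuppLEquivDirectSum A (W.simple i) (I i)).symm).length_eq
  rw [h1, Module.length_finsupp, Module.length_eq_one, mul_one]

/-- If `P ⧸ J(A) P ≅ ⨁ i, V_i ^ (I_i)`, then the `i`-th entry of the dimension vector is the
cardinality of `I_i` if `I_i` is finite, and `∞` otherwise. -/
theorem dim_eq_card (P : Type u) [AddCommGroup P] [Module A P] (I : Fin k → Type u)
    (e : (P ⧸ (Ring.jacobson A • ⊤ : Submodule A P)) ≃ₗ[A] ⨁ i, ⨁ _ : I i, W.simple i)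
    (i : Fin k) : dim W P i = ENat.card (I i) :=
  length_isotypicComponent W _ I e i

/-- The support of a vector. -/
def supp (x : Fin k → ℕ∞) : Set (Fin k) := {i | x i ≠ 0}

/-- The infinite support of a vector. -/
def infSupp (x : Fin k → ℕ∞) : Set (Fin k) := {i | x i = ⊤}

/-- The map `Φ`: it sends the trace ideal of a countably generated projective module `P` to the
support of the dimension vector of `P`. -/
def Phi (I : Ideal A) : Set (Fin k) :=
  {i | ∃ P : CGProj A, traceIdeal A P = I ∧ i ∈ supp (dim W P)}

end dim

end SemiSemi

/-!
Write `J` for the Jacobson radical and let `A` be the opposite ring of the semi-semiperfect ring, so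
that all modules are left `A`-modules. The proof rests on four facts.

* Countably generated projective modules over a semilocal ring are determined by their dimension
  vectors (`dimHom_injective`). Homomorphisms `P → Q` and `Q → P` that are inverse to each other
  modulo `J` can be corrected, by Nakayama's lemma, to be strictly inverse on any given finitely
  generated submodule (`InverseModRadical.exists_strict`), and a back-and-forth argument then gives
  an isomorphism. The same correction shows that a projective module `P` with `JP = P` is zero.
* The trace ideal of a projective module `P` is determined by the support of its dimension vector
  (`traceIdeal_eq_iff`): it acts nontrivially on exactly the simple quotients of `P`, and an ideal
  `I` that acts nontrivially on all simple quotients of `P` satisfies `IP = P`, because the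
  projective `A ⧸ I`-module `P ⧸ IP` has no simple quotient. Since the projective modules given by
  semi-semiperfectness have one-element supports, all subsets of the simple modules occur, so `Φ` is
  a bijection.
* For a semilocal ring `B` the monoid `V(B)` is finitely generated (`exists_finite_closure_eq_V`),
  since the dimension vectors of finitely generated projective modules form a subtractive submonoid
  of `ℕ ^ k`. If `I` is the trace ideal of a countably generated projective module, then finitely
  generated projective `A ⧸ I`-modules lift to countably generated projective `A`-modules
  (`exists_modIdeal_eq`): an idempotent matrix over `A ⧸ I` is lifted to an endomorphism `φ` of a
  larger projective module that becomes invertible on its range, and the mapping telescope of `φ` is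
  projective. This yields the sets `G_J`.
* If `X` is the set of the simple modules of infinite multiplicity in `P` and `Φ(I) = X`, then a
  multiple of `P` has the dimension vector of a direct sum of modules `P_i ^ (ω)` with `i ∈ X`,
  which vanish modulo `I`, and finitely many `P_i`. So `P ⧸ IP` is finitely generated
  (`modHom_cls_mem_V_of_infSupp`), hence a combination of the `Q ⧸ IQ` with `Q ∈ G_I`. The same
  combination of the `Q`, together with the `P_i ^ (ω)` for `i ∈ X`, has the dimension vector of
  `P`, and is therefore isomorphic to `P`.
-/

namespace SemiSemi

/-! ### Lifting modulo the Jacobson radical -/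

section radical

variable {A : Type u} [Ring A]

theorem exists_fg_mem_smul {M : Type*} [AddCommGroup M] [Module A M] (J : Ideal A) {x : M}
    (hx : x ∈ (J • ⊤ : Submodule A M)) : ∃ N : Submodule A M, N.FG ∧ x ∈ J • N := by
  induction hx using Submodule.smul_induction_on' with
  | smul r hr m _ =>
    exact ⟨Submodule.span A {m}, Submodule.fg_span_singleton m,
      Submodule.smul_mem_smul hr (Submodule.mem_span_singleton_self m)⟩
  | add x _ y _ hx hy =>
    obtain ⟨N, hN, hxN⟩ := hx
    obtain ⟨N', hN', hyN⟩ := hy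
    exact ⟨N ⊔ N', hN.sup hN', add_mem (Submodule.smul_mono le_rfl le_sup_left hxN)
      (Submodule.smul_mono le_rfl le_sup_right hyN)⟩

/-- A linear map that differs from the identity by a map into `J(A) N` is surjective if `N` is
finitely generated, by Nakayama's lemma. -/
theorem surjective_one_sub {F : Type*} [AddCommGroup F] [Module A F] {N : Submodule A F}
    (hN : N.FG) (k : F →ₗ[A] F) (hk : LinearMap.range k ≤ Ring.jacobson A • N) :
    Function.Surjective (LinearMap.id - k : F →ₗ[A] F) := by
  have hle : N ≤ LinearMap.range (LinearMap.id - k : F →ₗ[A] F) := by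
    set S := LinearMap.range (LinearMap.id - k : F →ₗ[A] F)
    have h0 : N.map S.mkQ ≤ Ring.jacobson A • N.map S.mkQ := by
      rw [← Submodule.map_smul'']
      rintro _ ⟨x, -, rfl⟩
      refine ⟨k x, hk ⟨x, rfl⟩, ?_⟩
      rw [eq_comm, ← sub_eq_zero, ← map_sub]
      exact (Submodule.Quotient.mk_eq_zero S).mpr ⟨x, rfl⟩
    have h1 := Submodule.FG.eq_bot_of_le_jacobson_smul (hN.map _) h0
    intro x hx
    have h2 : S.mkQ x ∈ N.map S.mkQ := ⟨x, hx, rfl⟩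
    rw [h1, Submodule.mem_bot] at h2
    exact (Submodule.Quotient.mk_eq_zero S).mp h2
  intro y
  obtain ⟨z, hz⟩ := hle (Submodule.smul_le_right (hk ⟨y, rfl⟩))
  refine ⟨y + z, ?_⟩
  rw [map_add, hz]
  simp

/-- On a projective module such a map is invertible: its right inverse is again of the same form. -/
theorem exists_leftInverse_one_sub {F : Type*} [AddCommGroup F] [Module A F]
    [Module.Projective A F] {N : Submodule A F} (hN : N.FG) (k : F →ₗ[A] F)
    (hk : LinearMap.range k ≤ Ring.jacobson A • N) :
    ∃ w : F →ₗ[A] F, w ∘ₗ (LinearMap.id - k : F →ₗ[A] F) = LinearMap.id ∧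
      LinearMap.range (w - LinearMap.id) ≤ Ring.jacobson A • N := by
  obtain ⟨w, hw⟩ := Module.projective_lifting_property (LinearMap.id - k : F →ₗ[A] F) LinearMap.id
    (surjective_one_sub hN k hk)
  have hw' : ∀ x, w x - k (w x) = x := fun x => LinearMap.congr_fun hw x
  have hrange : LinearMap.range (w - LinearMap.id) ≤ Ring.jacobson A • N := by
    rintro _ ⟨x, rfl⟩
    have : (w - LinearMap.id : F →ₗ[A] F) x = k (w x) := by
      rw [LinearMap.sub_apply, LinearMap.id_apply, sub_eq_iff_eq_add]
      rw [← sub_eq_iff_eq_add', hw']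
    rw [this]
    exact hk ⟨_, rfl⟩
  -- `w` is itself of the form `1 - k'`, so it is surjective as well
  have hsurj : Function.Surjective w := by
    have := surjective_one_sub hN (LinearMap.id - w : F →ₗ[A] F) (by
      rw [← neg_sub, LinearMap.range_neg]; exact hrange)
    rwa [sub_sub_cancel] at this
  refine ⟨w, ?_, hrange⟩
  ext x
  obtain ⟨y, rfl⟩ := hsurj x
  have : (LinearMap.id - k : F →ₗ[A] F) (w y) = y := hw' y
  rw [LinearMap.comp_apply, this]
  rfl

/-- If an endomorphism of a projective module is the identity modulo the radical, then on any finite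
set it can be inverted by an endomorphism that is the identity modulo the radical. The module need
not be finitely generated, so the endomorphism itself need not be invertible. -/
theorem exists_inverse_on_finset {P : Type*} [AddCommGroup P] [Module A P] [Module.Projective A P]
    (h : P →ₗ[A] P) (hh : LinearMap.range h ≤ Ring.jacobson A • ⊤) (s : Finset P) :
    ∃ v : P →ₗ[A] P, (∀ x ∈ s, v (x - h x) = x) ∧
      LinearMap.range (v - LinearMap.id) ≤ Ring.jacobson A • ⊤ := by
  classical
  obtain ⟨i, hi⟩ := Module.projective_def'.mp (inferInstance : Module.Projective A P)
  set e : (P →₀ A) →ₗ[A] P := Finsupp.linearCombination A id with he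
  have hei : ∀ x, e (i x) = x := fun x => LinearMap.congr_fun hi x
  set t : Finset P := s.biUnion fun x => (i x).support with ht
  let H : (P →₀ A) →ₗ[A] (P →₀ A) := i ∘ₗ h ∘ₗ e
  -- `H` is `h` transported to the free module; its truncation `k` to the basis elements in `t` agrees
  -- with it on `i '' s` and has image in `J(A) N'` for a finitely generated `N'`
  have hH : ∀ y, H y ∈ (Ring.jacobson A • ⊤ : Submodule A (P →₀ A)) := by
    intro y
    have h1 : i (h (e y)) ∈ (Ring.jacobson A • ⊤ : Submodule A P).map i := ⟨_, hh ⟨_, rfl⟩, rfl⟩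
    rw [Submodule.map_smul''] at h1
    exact Submodule.smul_mono le_rfl le_top h1
  choose N hNfg hN using fun y => exists_fg_mem_smul (Ring.jacobson A) (hH y)
  let N' : Submodule A (P →₀ A) := ⨆ q ∈ t, N (Finsupp.single q 1)
  have hN' : N'.FG := Submodule.fg_biSup t _ fun q _ => hNfg _
  let k : (P →₀ A) →ₗ[A] (P →₀ A) :=
    Finsupp.linearCombination A fun q => if q ∈ t then H (Finsupp.single q 1) else 0
  have hk : LinearMap.range k ≤ Ring.jacobson A • N' := by
    rw [Finsupp.range_linearCombination, Submodule.span_le]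
    rintro _ ⟨q, rfl⟩
    dsimp only
    split_ifs with hq
    · exact Submodule.smul_mono le_rfl (le_biSup (fun q => N (Finsupp.single q 1)) hq) (hN _)
    · exact Submodule.zero_mem _
  have hkH : ∀ x ∈ s, k (i x) = i (h x) := by
    intro x hx
    have h1 : k (i x) = H (i x) := by
      have h2 : H (i x) = Finsupp.linearCombination A (fun q => H (Finsupp.single q 1)) (i x) := by
        have h3 : H = Finsupp.linearCombination A (fun q => H (Finsupp.single q 1)) := by
          ext q
          simp
        exact LinearMap.congr_fun h3 (i x)
      rw [h2, Finsupp.linearCombination_apply, Finsupp.linearCombination_apply]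
      refine Finsupp.sum_congr fun q hq => ?_
      rw [if_pos (Finset.mem_biUnion.mpr ⟨x, hx, hq⟩)]
    rw [h1]
    simp [H, hei]
  obtain ⟨w, hw, hwr⟩ := exists_leftInverse_one_sub hN' k hk
  refine ⟨e ∘ₗ w ∘ₗ i, fun x hx => ?_, ?_⟩
  · have h1 : i (x - h x) = (LinearMap.id - k : (P →₀ A) →ₗ[A] (P →₀ A)) (i x) := by
      rw [map_sub, LinearMap.sub_apply, hkH x hx]; rfl
    rw [LinearMap.comp_apply, LinearMap.comp_apply, h1, ← LinearMap.comp_apply w, hw]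
    exact hei x
  · rintro _ ⟨x, rfl⟩
    have h1 : (e ∘ₗ w ∘ₗ i - LinearMap.id : P →ₗ[A] P) x =
        e ((w - LinearMap.id : (P →₀ A) →ₗ[A] (P →₀ A)) (i x)) := by
      simp [hei]
    rw [h1]
    have h2 : e ((w - LinearMap.id : (P →₀ A) →ₗ[A] (P →₀ A)) (i x)) ∈
        (Ring.jacobson A • N').map e := ⟨_, hwr ⟨_, rfl⟩, rfl⟩
    rw [Submodule.map_smul''] at h2
    exact Submodule.smul_mono le_rfl le_top h2

/-- A nonzero projective module is not equal to its radical (Bass). -/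
theorem subsingleton_of_jacobson_smul_eq_top {P : Type*} [AddCommGroup P] [Module A P]
    [Module.Projective A P] (h : (Ring.jacobson A • ⊤ : Submodule A P) = ⊤) : Subsingleton P := by
  refine subsingleton_of_forall_eq 0 fun x => ?_
  obtain ⟨v, hv, -⟩ :=
    exists_inverse_on_finset (A := A) (P := P) LinearMap.id (le_top.trans h.ge) {x}
  simpa using (hv x (Finset.mem_singleton_self x)).symm

/-- Compatible linear maps `f n`, injective on the members `S n` of an increasing sequence of
submodules exhausting `P`, with images exhausting `Q`, glue to an isomorphism. -/
theorem exists_limit_equiv {P Q : Type*} [AddCommGroup P] [Module A P] [AddCommGroup Q] [Module A Q]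
    (S : ℕ → Submodule A P) (f : ℕ → P →ₗ[A] Q) (hS : Monotone S)
    (hf : ∀ n, ∀ x ∈ S n, f (n + 1) x = f n x) (htop : ⨆ n, S n = ⊤)
    (hinj : ∀ n, ∀ x ∈ S n, f n x = 0 → x = 0) (hsurj : ⨆ n, (S n).map (f n) = ⊤) :
    Nonempty (P ≃ₗ[A] Q) := by
  have hmem : ∀ x, ∃ n, x ∈ S n := fun x =>
    (Submodule.mem_iSup_of_directed S hS.directed_le).mp (htop ▸ Submodule.mem_top)
  choose m hm using hmem
  have hle : ∀ n l, n ≤ l → ∀ x ∈ S n, f l x = f n x := by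
    intro n l hnl x hx
    induction l, hnl using Nat.le_induction with
    | base => rfl
    | succ l hnl ih => rw [hf l x (hS hnl hx), ih]
  have heq : ∀ n, ∀ x ∈ S n, f (m x) x = f n x := fun n x hx => by
    rw [← hle _ _ (le_max_left (m x) n) x (hm x), ← hle _ _ (le_max_right (m x) n) x hx]
  let g : P →ₗ[A] Q :=
    { toFun := fun x => f (m x) x
      map_add' := fun x y => by
        have hx := hS (le_max_left (m x) (m y)) (hm x)
        have hy := hS (le_max_right (m x) (m y)) (hm y)
        rw [heq _ _ hx, heq _ _ hy, heq _ _ (add_mem hx hy), map_add]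
      map_smul' := fun r x => by
        rw [heq _ _ (Submodule.smul_mem _ r (hm x)), map_smul]; rfl }
  refine ⟨LinearEquiv.ofBijective g ⟨(injective_iff_map_eq_zero g).mpr fun x hx => ?_, ?_⟩⟩
  · exact hinj _ x (hm x) hx
  · rw [← LinearMap.range_eq_top, eq_top_iff, ← hsurj]
    refine iSup_le fun n => ?_
    rintro _ ⟨x, hx, rfl⟩
    exact ⟨x, heq n x hx⟩

/-- The homomorphisms `f` and `g` are inverse to each other modulo the radical. -/
def InverseModRadical {P Q : Type*} [AddCommGroup P] [Module A P] [AddCommGroup Q] [Module A Q]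
    (f : P →ₗ[A] Q) (g : Q →ₗ[A] P) : Prop :=
  (∀ x, x - g (f x) ∈ (Ring.jacobson A • ⊤ : Submodule A P)) ∧
    ∀ y, y - f (g y) ∈ (Ring.jacobson A • ⊤ : Submodule A Q)

theorem map_mem_smul_top {P Q : Type*} [AddCommGroup P] [Module A P] [AddCommGroup Q] [Module A Q]
    (f : P →ₗ[A] Q) (I : Ideal A) {x : P} (hx : x ∈ (I • ⊤ : Submodule A P)) :
    f x ∈ (I • ⊤ : Submodule A Q) := by
  have h : f x ∈ (I • ⊤ : Submodule A P).map f := ⟨x, hx, rfl⟩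
  rw [Submodule.map_smul''] at h
  exact Submodule.smul_mono le_rfl le_top h

/-- A homomorphism that has an inverse modulo the radical has one which is an honest left inverse
on a given finitely generated submodule. -/
theorem InverseModRadical.exists_strict {P Q : Type*} [AddCommGroup P] [Module A P]
    [Module.Projective A P] [AddCommGroup Q] [Module A Q] {f : P →ₗ[A] Q} {g : Q →ₗ[A] P}
    (h : InverseModRadical f g) {S : Submodule A P} (hS : S.FG) :
    ∃ g' : Q →ₗ[A] P, InverseModRadical f g' ∧ ∀ x ∈ S, g' (f x) = x := by
  obtain ⟨s, rfl⟩ := hS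
  obtain ⟨v, hv, hvr⟩ := exists_inverse_on_finset (LinearMap.id - g ∘ₗ f : P →ₗ[A] P)
    (by rintro _ ⟨x, rfl⟩; exact h.1 x) s
  have hvr' : ∀ x, v x - x ∈ (Ring.jacobson A • ⊤ : Submodule A P) := fun x => hvr ⟨x, rfl⟩
  refine ⟨v ∘ₗ g, ⟨fun x => ?_, fun y => ?_⟩, ?_⟩
  · have := sub_mem (h.1 x) (hvr' (g (f x)))
    simpa using this
  · have := sub_mem (h.2 y) (map_mem_smul_top f _ (hvr' (g y)))
    simpa using this
  · intro x hx
    have : Submodule.span A (s : Set P) ≤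
        LinearMap.eqLocus ((v ∘ₗ g) ∘ₗ f) LinearMap.id := Submodule.span_le.mpr fun x hx => by
      have := hv x hx
      simpa using this
    exact this hx

theorem InverseModRadical.symm {P Q : Type*} [AddCommGroup P] [Module A P]
    [AddCommGroup Q] [Module A Q] {f : P →ₗ[A] Q} {g : Q →ₗ[A] P}
    (h : InverseModRadical f g) : InverseModRadical g f := ⟨h.2, h.1⟩

theorem exists_seq_span_eq_top {M : Type*} [AddCommGroup M] [Module A M]
    (h : ∃ s : Set M, s.Countable ∧ Submodule.span A s = ⊤) :
    ∃ x : ℕ → M, Submodule.span A (Set.range x) = ⊤ := by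
  obtain ⟨s, hs, hs'⟩ := h
  obtain ⟨x, hx⟩ := (hs.insert 0).exists_eq_range (Set.insert_nonempty 0 s)
  exact ⟨x, by rw [← hx, eq_top_iff, ← hs']; exact Submodule.span_mono (Set.subset_insert 0 s)⟩

/-- Countably generated projective modules with homomorphisms that are inverse to each other modulo
the radical are isomorphic (Příhoda). The isomorphism is built by a back-and-forth argument from
strict inverses on larger and larger finitely generated submodules. -/
theorem InverseModRadical.nonempty_equiv {P Q : Type*} [AddCommGroup P] [Module A P]
    [Module.Projective A P] [AddCommGroup Q] [Module A Q] [Module.Projective A Q]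
    (hP : ∃ s : Set P, s.Countable ∧ Submodule.span A s = ⊤)
    (hQ : ∃ s : Set Q, s.Countable ∧ Submodule.span A s = ⊤)
    {f : P →ₗ[A] Q} {g : Q →ₗ[A] P} (h : InverseModRadical f g) : Nonempty (P ≃ₗ[A] Q) := by
  obtain ⟨x, hx⟩ := exists_seq_span_eq_top hP
  obtain ⟨y, hy⟩ := exists_seq_span_eq_top hQ
  -- a state of the back-and-forth: the two maps and the submodule of `P` on which they are inverse
  let σ := {t : (P →ₗ[A] Q) × (Q →ₗ[A] P) × Submodule A P //
    InverseModRadical t.1 t.2.1 ∧ t.2.2.FG ∧ ∀ x ∈ t.2.2, t.2.1 (t.1 x) = x}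
  have step : ∀ (n : ℕ) (t : σ), ∃ t' : σ, t.1.2.2 ≤ t'.1.2.2 ∧
      (∀ x ∈ t.1.2.2, t'.1.1 x = t.1.1 x) ∧ x n ∈ t'.1.2.2 ∧ y n ∈ t'.1.2.2.map t'.1.1 := by
    rintro n ⟨⟨f, g, S⟩, hfg, hS, hS'⟩
    let T := S.map f ⊔ Submodule.span A {y n}
    have hT : T.FG := (hS.map f).sup (Submodule.fg_span_singleton _)
    obtain ⟨f', hf', hf'T⟩ := hfg.symm.exists_strict hT
    let S' := T.map g ⊔ Submodule.span A {x n}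
    have hS'fg : S'.FG := (hT.map g).sup (Submodule.fg_span_singleton _)
    obtain ⟨g', hg', hg'S⟩ := hf'.symm.exists_strict hS'fg
    have hfT : ∀ z ∈ S, f z ∈ T := fun z hz => Submodule.mem_sup_left ⟨z, hz, rfl⟩
    have hyT : y n ∈ T := Submodule.mem_sup_right (Submodule.mem_span_singleton_self _)
    refine ⟨⟨⟨f', g', S'⟩, hg', hS'fg, hg'S⟩, fun z hz => ?_, fun z hz => ?_, ?_, ?_⟩
    · exact Submodule.mem_sup_left ⟨f z, hfT z hz, hS' z hz⟩
    · have := hf'T (f z) (hfT z hz)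
      rwa [hS' z hz] at this
    · exact Submodule.mem_sup_right (Submodule.mem_span_singleton_self _)
    · exact ⟨g (y n), Submodule.mem_sup_left ⟨y n, hyT, rfl⟩, hf'T _ hyT⟩
  choose next hle heq hxn hyn using step
  let t : ℕ → σ := fun n => Nat.rec ⟨⟨f, g, ⊥⟩, h, Submodule.fg_bot, by simp⟩ next n
  refine exists_limit_equiv (fun n => (t n).1.2.2) (fun n => (t n).1.1)
    (monotone_nat_of_le_succ fun n => hle n (t n)) (fun n => heq n (t n)) ?_ ?_ ?_
  · rw [eq_top_iff, ← hx, Submodule.span_le]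
    rintro _ ⟨n, rfl⟩
    exact Submodule.mem_iSup_of_mem (n + 1) (hxn n (t n))
  · intro n z hz h0
    rw [← (t n).2.2.2 z hz, h0, map_zero]
  · rw [eq_top_iff, ← hy, Submodule.span_le]
    rintro _ ⟨n, rfl⟩
    exact Submodule.mem_iSup_of_mem (n + 1) (hyn n (t n))

/-- Countably generated projective modules with isomorphic radical factors are isomorphic
(Příhoda). -/
theorem nonempty_equiv_of_top_equiv {P Q : CGProj A}
    (e : (P ⧸ (Ring.jacobson A • ⊤ : Submodule A P)) ≃ₗ[A]
      (Q ⧸ (Ring.jacobson A • ⊤ : Submodule A Q))) : Nonempty (P ≃ₗ[A] Q) := by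
  obtain ⟨f, hf⟩ := Module.projective_lifting_property
    (Ring.jacobson A • ⊤ : Submodule A Q).mkQ
    (e.toLinearMap ∘ₗ (Ring.jacobson A • ⊤ : Submodule A P).mkQ) (Submodule.mkQ_surjective _)
  obtain ⟨g, hg⟩ := Module.projective_lifting_property
    (Ring.jacobson A • ⊤ : Submodule A P).mkQ
    (e.symm.toLinearMap ∘ₗ (Ring.jacobson A • ⊤ : Submodule A Q).mkQ) (Submodule.mkQ_surjective _)
  have hf' : ∀ x, Submodule.Quotient.mk (f x) = e (Submodule.Quotient.mk x) :=
    fun x => LinearMap.congr_fun hf x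
  have hg' : ∀ x, Submodule.Quotient.mk (g x) = e.symm (Submodule.Quotient.mk x) :=
    fun x => LinearMap.congr_fun hg x
  refine InverseModRadical.nonempty_equiv P.countablyGenerated Q.countablyGenerated
    (f := f) (g := g) ⟨fun x => ?_, fun y => ?_⟩
  · rw [← Submodule.Quotient.eq, hg', hf', e.symm_apply_apply]
  · rw [← Submodule.Quotient.eq, hf', hg', e.apply_symm_apply]

end radical

/-! ### Dimension vectors -/

section dimension

variable {A : Type u} [Ring A]

theorem smul_top_prod {P Q : Type*} [AddCommGroup P] [Module A P] [AddCommGroup Q] [Module A Q]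
    (I : Ideal A) : (I • ⊤ : Submodule A (P × Q)) = (I • ⊤ : Submodule A P).prod (I • ⊤) := by
  apply le_antisymm
  · intro x hx
    exact ⟨map_mem_smul_top (LinearMap.fst A P Q) I hx, map_mem_smul_top (LinearMap.snd A P Q) I hx⟩
  · rintro ⟨a, b⟩ ⟨ha, hb⟩
    have := add_mem (map_mem_smul_top (LinearMap.inl A P Q) I ha)
      (map_mem_smul_top (LinearMap.inr A P Q) I hb)
    simpa using this

/-- `(P × Q) ⧸ I(P × Q) ≅ P ⧸ IP × Q ⧸ IQ`. -/
noncomputable def quotSMulProdEquiv (P Q : Type*) [AddCommGroup P] [Module A P] [AddCommGroup Q]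
    [Module A Q] (I : Ideal A) :
    ((P × Q) ⧸ (I • ⊤ : Submodule A (P × Q))) ≃ₗ[A]
      (P ⧸ (I • ⊤ : Submodule A P)) × (Q ⧸ (I • ⊤ : Submodule A Q)) :=
  (Submodule.quotEquivOfEq _ _ (by
    rw [smul_top_prod, LinearMap.ker_prodMap, Submodule.ker_mkQ, Submodule.ker_mkQ])).trans
  (LinearMap.quotKerEquivOfSurjective
    ((I • ⊤ : Submodule A P).mkQ.prodMap (I • ⊤ : Submodule A Q).mkQ)
    ((Submodule.mkQ_surjective _).prodMap (Submodule.mkQ_surjective _)))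

/-- An isomorphism `P ≅ Q` induces `P ⧸ IP ≅ Q ⧸ IQ`. -/
noncomputable def quotSMulCongr {P Q : Type*} [AddCommGroup P] [Module A P] [AddCommGroup Q]
    [Module A Q] (I : Ideal A) (e : P ≃ₗ[A] Q) :
    (P ⧸ (I • ⊤ : Submodule A P)) ≃ₗ[A] (Q ⧸ (I • ⊤ : Submodule A Q)) :=
  Submodule.Quotient.equiv _ _ e (by
    rw [Submodule.map_smul'', Submodule.map_top, LinearEquiv.range])

theorem length_isotypicComponent_le_of_injective {M N : Type*} [AddCommGroup M] [Module A M]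
    [AddCommGroup N] [Module A N] (S : Type*) [AddCommGroup S] [Module A S] [IsSimpleModule A S]
    (f : M →ₗ[A] N) (hf : Function.Injective f) :
    Module.length A (isotypicComponent A M S) ≤ Module.length A (isotypicComponent A N S) :=
  Module.length_le_of_injective (f.restrict (f.le_comap_isotypicComponent S))
    fun _ _ h => Subtype.ext (hf (congrArg Subtype.val h))

theorem length_isotypicComponent_congr {M N : Type*} [AddCommGroup M] [Module A M]
    [AddCommGroup N] [Module A N] (S : Type*) [AddCommGroup S] [Module A S] [IsSimpleModule A S]
    (e : M ≃ₗ[A] N) :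
    Module.length A (isotypicComponent A M S) = Module.length A (isotypicComponent A N S) :=
  le_antisymm (length_isotypicComponent_le_of_injective S e.toLinearMap e.injective)
    (length_isotypicComponent_le_of_injective S e.symm.toLinearMap e.symm.injective)

theorem isotypicComponent_prod {M N : Type*} [AddCommGroup M] [Module A M]
    [AddCommGroup N] [Module A N] (S : Type*) [AddCommGroup S] [Module A S] [IsSimpleModule A S] :
    isotypicComponent A (M × N) S = (isotypicComponent A M S).prod (isotypicComponent A N S) := by
  apply le_antisymm
  · intro x hx
    exact ⟨(LinearMap.fst A M N).le_comap_isotypicComponent S hx,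
      (LinearMap.snd A M N).le_comap_isotypicComponent S hx⟩
  · rintro ⟨a, b⟩ ⟨ha : a ∈ isotypicComponent A M S, hb : b ∈ isotypicComponent A N S⟩
    have ha' : LinearMap.inl A M N a ∈ isotypicComponent A (M × N) S :=
      LinearMap.le_comap_isotypicComponent S (LinearMap.inl A M N) ha
    have hb' : LinearMap.inr A M N b ∈ isotypicComponent A (M × N) S :=
      LinearMap.le_comap_isotypicComponent S (LinearMap.inr A M N) hb
    simpa using add_mem ha' hb'

theorem length_isotypicComponent_prod (M N : Type*) [AddCommGroup M] [Module A M]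
    [AddCommGroup N] [Module A N] (S : Type*) [AddCommGroup S] [Module A S] [IsSimpleModule A S] :
    Module.length A (isotypicComponent A (M × N) S) =
      Module.length A (isotypicComponent A M S) + Module.length A (isotypicComponent A N S) := by
  rw [isotypicComponent_prod, ← Module.length_prod]
  let e : (isotypicComponent A M S).prod (isotypicComponent A N S) ≃ₗ[A]
      isotypicComponent A M S × isotypicComponent A N S :=
    { toFun := fun x => (⟨x.1.1, x.2.1⟩, ⟨x.1.2, x.2.2⟩)
      invFun := fun x => ⟨(x.1, x.2), x.1.2, x.2.2⟩
      map_add' := fun _ _ => rfl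
      map_smul' := fun _ _ => rfl
      left_inv := fun _ => rfl
      right_inv := fun _ => rfl }
  exact e.length_eq

/-- Over a semilocal ring, a module killed by the radical is semisimple. -/
theorem isSemisimpleModule_of_jacobson_smul_eq_zero (hA : IsSemisimpleRing (A ⧸ Ring.jacobson A))
    {M : Type*} [AddCommGroup M] [Module A M]
    (h : ∀ r ∈ Ring.jacobson A, ∀ m : M, r • m = 0) : IsSemisimpleModule A M := by
  let l : (A ⧸ Ring.jacobson A) →ₛₗ[Ideal.Quotient.mk (Ring.jacobson A)] (A ⧸ Ring.jacobson A) :=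
    { toFun := id
      map_add' := fun _ _ => rfl
      map_smul' := fun _ _ => rfl }
  have hA' : IsSemisimpleModule A (A ⧸ Ring.jacobson A) :=
    (LinearMap.isSemisimpleModule_iff_of_bijective l Function.bijective_id).mpr hA
  let f : M → (A ⧸ Ring.jacobson A) →ₗ[A] M := fun m =>
    (Ring.jacobson A).liftQ (LinearMap.toSpanSingleton A M m) fun r hr => h r hr m
  refine isSemisimpleModule_of_isSemisimpleModule_submodule' (p := fun m => LinearMap.range (f m))
    (fun m => IsSemisimpleModule.range (f m)) (Submodule.eq_top_iff'.mpr fun m => ?_)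
  refine Submodule.mem_iSup_of_mem m ⟨Submodule.Quotient.mk 1, ?_⟩
  exact (Submodule.liftQ_apply (Ring.jacobson A) _ _).trans (one_smul A m)

theorem smul_eq_zero_of_quotient_smul_top {P : Type*} [AddCommGroup P] [Module A P] (I : Ideal A)
    (r : A) (hr : r ∈ I) (x : P ⧸ (I • ⊤ : Submodule A P)) : r • x = 0 := by
  obtain ⟨x, rfl⟩ := Submodule.Quotient.mk_surjective _ x
  rw [← Submodule.Quotient.mk_smul, Submodule.Quotient.mk_eq_zero]
  exact Submodule.smul_mem_smul hr Submodule.mem_top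

theorem isSemisimpleModule_top (hA : IsSemisimpleRing (A ⧸ Ring.jacobson A))
    (P : Type*) [AddCommGroup P] [Module A P] :
    IsSemisimpleModule A (P ⧸ (Ring.jacobson A • ⊤ : Submodule A P)) :=
  isSemisimpleModule_of_jacobson_smul_eq_zero hA (smul_eq_zero_of_quotient_smul_top _)

variable {k : ℕ} (W : SimpleReps A k)

/-- A semisimple module is a direct sum of copies of the representatives of the simple modules. -/
theorem SimpleReps.exists_decomposition (M : Type u) [AddCommGroup M] [Module A M]
    [IsSemisimpleModule A M] :
    ∃ I : Fin k → Type u, Nonempty (M ≃ₗ[A] ⨁ i, ⨁ _ : I i, W.simple i) := by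
  classical
  obtain ⟨s, e, -, hs⟩ := IsSemisimpleModule.exists_linearEquiv_dfinsupp A M
  choose i hi using fun m : s => W.exists_iso m.1 (hs m)
  refine ⟨fun j => {m : s // i m = j}, ⟨?_⟩⟩
  have e1 : (Π₀ m : s, m.1) ≃ₗ[A] ⨁ m : s, W.simple (i m) :=
    DFinsupp.mapRange.linearEquiv fun m => (hi m).some
  have e2 : (⨁ m : s, W.simple (i m)) ≃ₗ[A]
      ⨁ x : (Σ j, {m : s // i m = j}), W.simple (i ((Equiv.sigmaFiberEquiv i) x)) :=
    (DirectSum.lequivCongrLeft A (Equiv.sigmaFiberEquiv i).symm)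
  have e3 : (⨁ x : (Σ j, {m : s // i m = j}), W.simple (i ((Equiv.sigmaFiberEquiv i) x))) ≃ₗ[A]
      ⨁ x : (Σ j, {m : s // i m = j}), W.simple x.1 :=
    DFinsupp.mapRange.linearEquiv fun x =>
      LinearEquiv.cast (R := A) (M := W.simple) (i := i ((Equiv.sigmaFiberEquiv i) x)) (j := x.1)
        x.2.2
  exact e.trans (e1.trans (e2.trans (e3.trans (DirectSum.sigmaLcurryEquiv A
    (α := fun j => {m : s // i m = j}) (δ := fun j _ => W.simple j)))))

/-- If a countably generated module maps onto a direct sum of nonzero modules, then there are only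
countably many summands. -/
theorem countable_of_countablyGenerated {M : Type*} [AddCommGroup M] [Module A M]
    (hM : ∃ s : Set M, s.Countable ∧ Submodule.span A s = ⊤) {ι : Type*} (N : ι → Type*)
    [∀ i, AddCommGroup (N i)] [∀ i, Module A (N i)] [∀ i, Nontrivial (N i)]
    (f : M →ₗ[A] ⨁ i, N i) (hf : Function.Surjective f) : Countable ι := by
  classical
  obtain ⟨s, hs, hs'⟩ := hM
  have hsupp : (⋃ x ∈ s, {i | f x i ≠ 0}).Countable :=
    hs.biUnion fun x _ => (DFinsupp.finite_support (f x)).countable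
  refine Set.countable_univ_iff.mp (hsupp.mono fun i _ => ?_)
  by_contra hi
  simp only [Set.mem_iUnion, not_exists] at hi
  have hz : ∀ x, f x i = 0 := by
    have : Submodule.span A s ≤ LinearMap.ker (DirectSum.component A ι N i ∘ₗ f) :=
      Submodule.span_le.mpr fun x hx => not_not.mp (hi x hx)
    intro x
    exact this (hs' ▸ Submodule.mem_top)
  obtain ⟨y, hy⟩ := exists_ne (0 : N i)
  obtain ⟨x, hx⟩ := hf (DirectSum.lof A ι N i y)
  apply hy
  rw [← hz x, hx, DirectSum.lof_eq_of, DirectSum.of_eq_same]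

theorem quotient_countablyGenerated {M : Type*} [AddCommGroup M] [Module A M]
    (hM : ∃ s : Set M, s.Countable ∧ Submodule.span A s = ⊤) (N : Submodule A M) :
    ∃ s : Set (M ⧸ N), s.Countable ∧ Submodule.span A s = ⊤ := by
  obtain ⟨s, hs, hs'⟩ := hM
  exact ⟨N.mkQ '' s, hs.image _, by rw [Submodule.span_image, hs', Submodule.map_top,
    Submodule.range_mkQ]⟩

/-- Countably generated semisimple modules with equal multiplicities are isomorphic. -/
theorem SimpleReps.nonempty_equiv {M N : Type u} [AddCommGroup M] [Module A M]
    [IsSemisimpleModule A M] [AddCommGroup N] [Module A N] [IsSemisimpleModule A N]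
    (hM : ∃ s : Set M, s.Countable ∧ Submodule.span A s = ⊤)
    (hN : ∃ s : Set N, s.Countable ∧ Submodule.span A s = ⊤)
    (h : ∀ i, Module.length A (isotypicComponent A M (W.simple i)) =
      Module.length A (isotypicComponent A N (W.simple i))) : Nonempty (M ≃ₗ[A] N) := by
  classical
  obtain ⟨I, ⟨e⟩⟩ := W.exists_decomposition M
  obtain ⟨I', ⟨e'⟩⟩ := W.exists_decomposition N
  have := fun i => IsSimpleModule.nontrivial A (W.simple i)
  have hI : ∀ i, Countable (I i) := fun i => countable_of_countablyGenerated hM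
    (fun _ => W.simple i)
    (DirectSum.component A (Fin k) (fun i => ⨁ _ : I i, W.simple i) i ∘ₗ e.toLinearMap)
    (fun y => ⟨e.symm (DirectSum.lof A (Fin k) (fun i => ⨁ _ : I i, W.simple i) i y), by
      rw [LinearMap.comp_apply, LinearEquiv.coe_coe, LinearEquiv.apply_symm_apply]
      exact DirectSum.component.lof_self ..⟩)
  have hI' : ∀ i, Countable (I' i) := fun i => countable_of_countablyGenerated hN
    (fun _ => W.simple i)
    (DirectSum.component A (Fin k) (fun i => ⨁ _ : I' i, W.simple i) i ∘ₗ e'.toLinearMap)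
    (fun y => ⟨e'.symm (DirectSum.lof A (Fin k) (fun i => ⨁ _ : I' i, W.simple i) i y), by
      rw [LinearMap.comp_apply, LinearEquiv.coe_coe, LinearEquiv.apply_symm_apply]
      exact DirectSum.component.lof_self ..⟩)
  have hII : ∀ i, Nonempty (I i ≃ I' i) := fun i => by
    have h' : ENat.card (I i) = ENat.card (I' i) := by
      rw [← length_isotypicComponent W M I e i, ← length_isotypicComponent W N I' e' i, h i]
    exact Cardinal.eq.mp (Cardinal.toENat_injOn (Cardinal.mk_le_aleph0_iff.mpr (hI i))
      (Cardinal.mk_le_aleph0_iff.mpr (hI' i)) h')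
  have e1 : (⨁ i, ⨁ _ : I i, W.simple i) ≃ₗ[A] ⨁ i, ⨁ _ : I' i, W.simple i :=
    DFinsupp.mapRange.linearEquiv fun i => DirectSum.lequivCongrLeft A (hII i).some
  exact ⟨e.trans (e1.trans e'.symm)⟩

theorem dim_congr {P Q : Type u} [AddCommGroup P] [Module A P] [AddCommGroup Q] [Module A Q]
    (e : P ≃ₗ[A] Q) (i : Fin k) : dim W P i = dim W Q i :=
  length_isotypicComponent_congr (W.simple i) (quotSMulCongr _ e)

theorem dim_prod (P Q : Type u) [AddCommGroup P] [Module A P] [AddCommGroup Q] [Module A Q]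
    (i : Fin k) : dim W (P × Q) i = dim W P i + dim W Q i :=
  (length_isotypicComponent_congr (W.simple i) (quotSMulProdEquiv P Q _)).trans
    (length_isotypicComponent_prod _ _ _)

/-- The dimension vector as a homomorphism from `V*(A)`. -/
noncomputable def dimHom : VStar A →+ (Fin k → ℕ∞) where
  toFun := Quotient.lift (fun P i => dim W P i) fun _ _ ⟨e⟩ => funext fun i => dim_congr W e i
  map_zero' := by
    funext i
    have : Subsingleton (CGProj.zero A) := inferInstanceAs (Subsingleton PUnit)
    exact Module.length_eq_zero
  map_add' := by
    rintro ⟨P⟩ ⟨Q⟩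
    exact funext fun i => dim_prod W P Q i

theorem dimHom_cls (P : CGProj A) : dimHom W (cls P) = dim W P := rfl

/-- Over a semilocal ring, countably generated projective modules are determined by their dimension
vectors. -/
theorem dimHom_injective (hA : IsSemisimpleRing (A ⧸ Ring.jacobson A)) :
    Function.Injective (dimHom W) := by
  rintro ⟨P⟩ ⟨Q⟩ h
  have := isSemisimpleModule_top hA P
  have := isSemisimpleModule_top hA Q
  obtain ⟨e⟩ := W.nonempty_equiv (quotient_countablyGenerated P.countablyGenerated _)
    (quotient_countablyGenerated Q.countablyGenerated _) (congrFun h)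
  exact Quotient.sound (nonempty_equiv_of_top_equiv e)

theorem exists_surjective_of_le_length {M : Type u} [AddCommGroup M] [Module A M]
    [IsSemisimpleModule A M] {n : ℕ} {i : Fin k}
    (h : n ≤ Module.length A (isotypicComponent A M (W.simple i))) :
    ∃ f : M →ₗ[A] (Fin n → W.simple i), Function.Surjective f := by
  classical
  obtain ⟨I, ⟨e⟩⟩ := W.exists_decomposition M
  rw [length_isotypicComponent W M I e i] at h
  obtain ⟨j⟩ : Nonempty (Fin n ↪ I i) := by
    have h1 : Cardinal.mk (ULift.{u} (Fin n)) ≤ Cardinal.mk (I i) := by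
      rw [Cardinal.mk_uLift, Cardinal.mk_fin, Cardinal.lift_natCast]
      exact Cardinal.natCast_le_toENat.mp h
    exact ⟨Equiv.ulift.symm.toEmbedding.trans (Cardinal.le_def _ _ |>.mp h1).some⟩
  let f : (⨁ i, ⨁ _ : I i, W.simple i) →ₗ[A] (Fin n → W.simple i) :=
    LinearMap.pi fun a => DirectSum.component A (I i) (fun _ => W.simple i) (j a) ∘ₗ
      DirectSum.component A (Fin k) (fun i => ⨁ _ : I i, W.simple i) i
  have hf : Function.Surjective f := fun y => by
    refine ⟨DirectSum.lof A (Fin k) (fun i => ⨁ _ : I i, W.simple i) i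
      (∑ a, DirectSum.lof A (I i) (fun _ => W.simple i) (j a) (y a)), ?_⟩
    funext b
    simp only [f, LinearMap.pi_apply, LinearMap.comp_apply, DirectSum.component.lof_self, map_sum]
    rw [Finset.sum_eq_single b]
    · exact DirectSum.component.lof_self ..
    · intro a _ hab
      rw [DirectSum.component.of, dif_neg]
      exact fun h => hab (j.injective h)
    · simp
  exact ⟨f ∘ₗ e.toLinearMap, hf.comp e.surjective⟩

theorem jacobson_smul_top_le_ker {P S : Type*} [AddCommGroup P] [Module A P] [AddCommGroup S]
    [Module A S] [IsSemisimpleModule A S] (f : P →ₗ[A] S) :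
    (Ring.jacobson A • ⊤ : Submodule A P) ≤ LinearMap.ker f := by
  rw [Submodule.smul_le]
  intro r hr x _
  rw [LinearMap.mem_ker, map_smul]
  exact Module.mem_annihilator.mp (IsSemisimpleModule.jacobson_le_annihilator A _ hr) _

/-- A multiplicity is at least `n` if and only if there is a surjection onto `n` copies of the
simple module. -/
theorem le_dim_iff (hA : IsSemisimpleRing (A ⧸ Ring.jacobson A)) (P : Type u) [AddCommGroup P]
    [Module A P] (i : Fin k) (n : ℕ) :
    n ≤ dim W P i ↔ ∃ f : P →ₗ[A] (Fin n → W.simple i), Function.Surjective f := by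
  have hss := isSemisimpleModule_top hA P
  constructor
  · intro h
    obtain ⟨f, hf⟩ := exists_surjective_of_le_length W h
    exact ⟨f ∘ₗ Submodule.mkQ _, hf.comp (Submodule.mkQ_surjective _)⟩
  · rintro ⟨f, hf⟩
    let g := (Ring.jacobson A • ⊤ : Submodule A P).liftQ f (jacobson_smul_top_le_ker f)
    have hg : Function.Surjective g := fun y => by
      obtain ⟨x, rfl⟩ := hf y
      exact ⟨Submodule.Quotient.mk x, Submodule.liftQ_apply ..⟩
    obtain ⟨s, hs⟩ := IsSemisimpleModule.lifting_property g hg LinearMap.id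
    have hs' : Function.Injective s :=
      Function.LeftInverse.injective (g := g) fun x => LinearMap.congr_fun hs x
    have h1 := length_isotypicComponent_le_of_injective (W.simple i) s hs'
    refine le_trans (le_of_eq ?_) h1
    have h2 : isotypicComponent A (Fin n → W.simple i) (W.simple i) = ⊤ := by
      rw [eq_top_iff]
      intro x _
      rw [← Finset.univ_sum_single x]
      refine Submodule.sum_mem _ fun a _ => ?_
      refine (le_sSup ?_ : LinearMap.range (LinearMap.single A (fun _ : Fin n => W.simple i) a) ≤ _)
        ⟨x a, rfl⟩
      exact ⟨(LinearEquiv.ofInjective (LinearMap.single A (fun _ : Fin n => W.simple i) a)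
        fun x y h => by simpa using congrFun h a).symm⟩
    rw [h2, Module.length_top, Module.length_pi]
    simp

theorem dim_ne_zero_iff (hA : IsSemisimpleRing (A ⧸ Ring.jacobson A)) (P : Type u) [AddCommGroup P]
    [Module A P] (i : Fin k) : dim W P i ≠ 0 ↔ ∃ f : P →ₗ[A] W.simple i, f ≠ 0 := by
  have h1 : dim W P i ≠ 0 ↔ ((1 : ℕ) : ℕ∞) ≤ dim W P i := by
    rw [Nat.cast_one, Order.one_le_iff_ne_zero]
  rw [h1, le_dim_iff W hA]
  have := IsSimpleModule.nontrivial A (W.simple i)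
  constructor
  · rintro ⟨f, hf⟩
    obtain ⟨y, hy⟩ := exists_ne (0 : W.simple i)
    obtain ⟨x, hx⟩ := hf fun _ => y
    refine ⟨LinearMap.proj 0 ∘ₗ f, fun h => hy ?_⟩
    have h1 : f x 0 = 0 := LinearMap.congr_fun h x
    rwa [hx] at h1
  · rintro ⟨f, hf⟩
    refine ⟨LinearMap.pi fun _ => f, fun y => ?_⟩
    obtain ⟨x, hx⟩ := (LinearMap.surjective_of_ne_zero hf) (y 0)
    exact ⟨x, funext fun a => by rw [Subsingleton.elim a 0]; exact hx⟩

theorem dim_ne_top (hA : IsSemisimpleRing (A ⧸ Ring.jacobson A)) (P : Type u) [AddCommGroup P]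
    [Module A P] [Module.Finite A P] (i : Fin k) : dim W P i ≠ ⊤ := by
  have hss := isSemisimpleModule_top hA P
  exact Module.length_ne_top

end dimension

/-! ### Semilocal rings: simple modules and the monoid `V` -/

section semilocal

variable {A : Type u} [Ring A]

/-- A semilocal ring has only finitely many simple modules up to isomorphism: each of them occurs in
the semisimple module `A ⧸ J(A)`. -/
theorem exists_simpleReps (hA : IsSemisimpleRing (A ⧸ Ring.jacobson A)) :
    ∃ k : ℕ, Nonempty (SimpleReps A k) := by
  classical
  have hss : IsSemisimpleModule A (A ⧸ Ring.jacobson A) :=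
    isSemisimpleModule_of_jacobson_smul_eq_zero hA fun r hr x => by
      obtain ⟨x, rfl⟩ := Ideal.Quotient.mk_surjective x
      exact Ideal.Quotient.eq_zero_iff_mem.mpr (Ideal.mul_mem_right x _ hr)
  obtain ⟨n, S, e, hS⟩ :=
    IsSemisimpleModule.exists_linearEquiv_fin_dfinsupp A (A ⧸ Ring.jacobson A)
  let r : Setoid (Fin n) :=
    { r := fun i j => Nonempty (S i ≃ₗ[A] S j)
      iseqv := ⟨fun _ => ⟨.refl _ _⟩, fun ⟨e⟩ => ⟨e.symm⟩, fun ⟨e⟩ ⟨f⟩ => ⟨e.trans f⟩⟩ }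
  let E := Finite.equivFin (Quotient r)
  refine ⟨Nat.card (Quotient r), ⟨{
    simple := fun i => S (E.symm i).out
    isSimple := fun i => hS _
    eq_of_iso := ?_
    exists_iso := ?_ }⟩⟩
  · intro i j h
    exact E.symm.injective (Quotient.out_equiv_out.mp h)
  · intro T _ _ hT
    obtain ⟨t, ht⟩ := @exists_ne T (IsSimpleModule.nontrivial A T) 0
    let f := (Ring.jacobson A).liftQ (LinearMap.toSpanSingleton A T t) fun r hr =>
      Module.mem_annihilator.mp (IsSemisimpleModule.jacobson_le_annihilator A T hr) t
    let g := f ∘ₗ e.symm.toLinearMap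
    obtain ⟨i, hi⟩ : ∃ i, g ∘ₗ DFinsupp.lsingle i ≠ 0 := by
      by_contra! h
      have hg : g = 0 := DFinsupp.lhom_ext' fun i => by rw [h i, LinearMap.zero_comp]
      apply ht
      have h1 : g (e (Submodule.Quotient.mk 1)) = t := by
        simp only [g, LinearMap.comp_apply, LinearEquiv.coe_coe, LinearEquiv.symm_apply_apply]
        exact (Submodule.liftQ_apply _ _ _).trans (one_smul A t)
      rw [← h1, hg, LinearMap.zero_apply]
    have hb := (LinearMap.bijective_or_eq_zero (g ∘ₗ DFinsupp.lsingle i)).resolve_right hi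
    refine ⟨E (Quotient.mk r i), ?_⟩
    obtain ⟨e'⟩ : Nonempty (S (Quotient.mk r i).out ≃ₗ[A] S i) := Quotient.mk_out (s := r) i
    rw [E.symm_apply_apply]
    exact ⟨(LinearEquiv.ofBijective _ hb).symm.trans e'.symm⟩

/-- A form of Nakayama's lemma. -/
theorem surjective_of_range_sup_eq_top {P Q : Type*} [AddCommGroup P] [Module A P] [AddCommGroup Q]
    [Module A Q] [Module.Finite A Q] (f : P →ₗ[A] Q)
    (h : LinearMap.range f ⊔ Ring.jacobson A • ⊤ = ⊤) : Function.Surjective f := by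
  have h1 := congrArg (Submodule.map (LinearMap.range f).mkQ) h
  rw [Submodule.map_sup, Submodule.mkQ_map_self, bot_sup_eq, Submodule.map_smul'',
    Submodule.map_top, Submodule.range_mkQ] at h1
  have h2 : (⊤ : Submodule A (Q ⧸ LinearMap.range f)) = ⊥ :=
    Submodule.FG.eq_bot_of_le_jacobson_smul Module.Finite.fg_top h1.ge
  intro y
  have h3 : (LinearMap.range f).mkQ y ∈ (⊤ : Submodule A (Q ⧸ LinearMap.range f)) :=
    Submodule.mem_top
  rw [h2, Submodule.mem_bot] at h3
  exact (Submodule.Quotient.mk_eq_zero _).mp h3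

/-- A split surjection gives a product decomposition. -/
def equivProdKer {P Q : Type*} [AddCommGroup P] [Module A P] [AddCommGroup Q]
    [Module A Q] (f : P →ₗ[A] Q) (s : Q →ₗ[A] P) (h : f ∘ₗ s = LinearMap.id) :
    P ≃ₗ[A] Q × LinearMap.ker f where
  toFun x := (f x, ⟨x - s (f x), by
    have := LinearMap.congr_fun h (f x)
    simp only [LinearMap.comp_apply, LinearMap.id_apply] at this
    rw [LinearMap.mem_ker, map_sub, this, sub_self]⟩)
  invFun x := s x.1 + x.2
  map_add' x y := by ext <;> simp [add_sub_add_comm]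
  map_smul' r x := by ext <;> simp [smul_sub]
  left_inv x := by simp
  right_inv x := by
    have := LinearMap.congr_fun h x.1
    simp only [LinearMap.comp_apply, LinearMap.id_apply] at this
    ext <;> simp [this]

theorem countablyGenerated_of_finite (M : Type*) [AddCommGroup M] [Module A M] [Module.Finite A M] :
    ∃ s : Set M, s.Countable ∧ Submodule.span A s = ⊤ := by
  obtain ⟨s, hs⟩ := Module.Finite.fg_top (R := A) (M := M)
  exact ⟨s, s.countable_toSet, hs⟩

theorem mem_V_iff (P : CGProj A) : cls P ∈ V A ↔ Module.Finite A P := by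
  constructor
  · rintro ⟨Q, hQ, h⟩
    obtain ⟨e⟩ : Nonempty (Q ≃ₗ[A] P) := Quotient.exact h
    exact Module.Finite.equiv e
  · exact fun h => ⟨P, h, rfl⟩

theorem mem_V_of_add_mem {x y : VStar A} (h : x + y ∈ V A) : x ∈ V A := by
  induction x using Quotient.inductionOn with | _ P
  induction y using Quotient.inductionOn with | _ Q
  have : Module.Finite A (P × Q) := (mem_V_iff (P.add Q)).mp h
  exact (mem_V_iff P).mpr
    (Module.Finite.of_surjective (LinearMap.fst A P Q) LinearMap.fst_surjective)

/-- If the dimension vector of `Q` dominates that of `P`, for finitely generated projective `P` and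
`Q`, then `P` is a direct summand of `Q`, so the difference is again a dimension vector. -/
theorem exists_complement (hA : IsSemisimpleRing (A ⧸ Ring.jacobson A)) {k : ℕ} (W : SimpleReps A k)
    (P Q : CGProj A) [Module.Finite A P] [Module.Finite A Q] (y : Fin k → ℕ)
    (h : ∀ i, dim W Q i = dim W P i + y i) :
    ∃ K : CGProj A, Module.Finite A K ∧ ∀ i, dim W K i = y i := by
  let M := ⨁ i, ⨁ _ : ULift.{u} (Fin (y i)), W.simple i
  have hM : Module.Finite A M := inferInstance
  have hMss : IsSemisimpleModule A M := inferInstanceAs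
    (IsSemisimpleModule A (Π₀ i, Π₀ _ : ULift.{u} (Fin (y i)), W.simple i))
  have := isSemisimpleModule_top hA P
  have := isSemisimpleModule_top hA Q
  have : IsSemisimpleModule A ((P ⧸ (Ring.jacobson A • ⊤ : Submodule A P)) × M) :=
    isSemisimpleModule_of_jacobson_smul_eq_zero hA fun r hr x => Prod.ext
      (smul_eq_zero_of_quotient_smul_top _ r hr x.1)
      (Module.mem_annihilator.mp (IsSemisimpleModule.jacobson_le_annihilator A M hr) x.2)
  obtain ⟨e⟩ := W.nonempty_equiv (M := Q ⧸ (Ring.jacobson A • ⊤ : Submodule A Q))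
    (N := (P ⧸ (Ring.jacobson A • ⊤ : Submodule A P)) × M)
    (countablyGenerated_of_finite _) (countablyGenerated_of_finite _) (fun i => by
      rw [length_isotypicComponent_prod, length_isotypicComponent W M _ (.refl A M) i]
      refine (h i).trans ?_
      congr 1
      simp)
  let JP : Submodule A P := Ring.jacobson A • ⊤
  let JQ : Submodule A Q := Ring.jacobson A • ⊤
  obtain ⟨f, hf⟩ := Module.projective_lifting_property JP.mkQ
    (LinearMap.fst A (P ⧸ JP) M ∘ₗ e.toLinearMap ∘ₗ JQ.mkQ) (Submodule.mkQ_surjective _)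
  have hsurj : Function.Surjective f := surjective_of_range_sup_eq_top f (by
    rw [eq_top_iff]
    intro x _
    obtain ⟨q, hq⟩ := JQ.mkQ_surjective (e.symm (JP.mkQ x, 0))
    have h1 : JP.mkQ (f q) = JP.mkQ x := by
      refine (LinearMap.congr_fun hf q).trans ?_
      rw [LinearMap.comp_apply, LinearMap.comp_apply, hq, LinearEquiv.coe_coe,
        LinearEquiv.apply_symm_apply]
      rfl
    have h2 : f q - x ∈ JP := (Submodule.Quotient.eq JP).mp h1
    rw [← sub_sub_self (f q) x]
    exact sub_mem (Submodule.mem_sup_left ⟨q, rfl⟩) (Submodule.mem_sup_right h2))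
  obtain ⟨s, hs⟩ := Module.projective_lifting_property f LinearMap.id hsurj
  let E := equivProdKer f s hs
  have hK : Module.Finite A (LinearMap.ker f) :=
    Module.Finite.of_surjective (LinearMap.snd A P (LinearMap.ker f) ∘ₗ E.toLinearMap)
      (Prod.snd_surjective.comp E.surjective)
  have hKp : Module.Projective A (LinearMap.ker f) :=
    Module.Projective.of_split (E.symm.toLinearMap ∘ₗ LinearMap.inr A P (LinearMap.ker f))
      (LinearMap.snd A P (LinearMap.ker f) ∘ₗ E.toLinearMap) (by
        ext x
        simp)
  refine ⟨{ carrier := LinearMap.ker f, countablyGenerated := countablyGenerated_of_finite _ }, hK,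
    fun i => ?_⟩
  have h1 := (dim_congr W E i).symm.trans (h i)
  rw [dim_prod] at h1
  exact WithTop.add_left_cancel (dim_ne_top W hA P i) h1

/-- Over a semilocal ring the monoid `V(A)` is finitely generated: the dimension vectors of finitely
generated projective modules form a subtractive submonoid of `ℕ ^ k`. -/
theorem exists_finite_closure_eq_V (hA : IsSemisimpleRing (A ⧸ Ring.jacobson A)) :
    ∃ s : Set (CGProj A), s.Finite ∧ (∀ P ∈ s, Module.Finite A P) ∧
      AddSubmonoid.closure (cls '' s) = V A := by
  obtain ⟨k, ⟨W⟩⟩ := exists_simpleReps hA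
  let S : AddSubmonoid (Fin k → ℕ) :=
    { carrier := {v | ∃ P : CGProj A, Module.Finite A P ∧ ∀ i, dim W P i = v i}
      zero_mem' := ⟨CGProj.zero A, inferInstanceAs (Module.Finite A PUnit.{u + 1}), fun i =>
        congrFun (map_zero (dimHom W)) i⟩
      add_mem' := by
        rintro v w ⟨P, hP, hPv⟩ ⟨Q, hQ, hQw⟩
        refine ⟨P.add Q, inferInstanceAs (Module.Finite A (P × Q)), fun i => ?_⟩
        rw [Pi.add_apply, Nat.cast_add, ← hPv, ← hQw]
        exact dim_prod W P Q i }
  obtain ⟨t, ht⟩ : S.FG := AddSubmonoid.fg_of_subtractive (by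
    rintro x ⟨P, hP, hPx⟩ y ⟨Q, hQ, hQxy⟩
    exact exists_complement hA W P Q y fun i => by rw [hQxy, hPx, Pi.add_apply, Nat.cast_add])
  have htS : ∀ v : t, v.1 ∈ S := fun v => ht ▸ AddSubmonoid.subset_closure v.2
  choose P hP hPv using htS
  refine ⟨Set.range P, Set.finite_range P, by rintro _ ⟨v, rfl⟩; exact hP v, le_antisymm ?_ ?_⟩
  · rw [AddSubmonoid.closure_le]
    rintro _ ⟨_, ⟨v, rfl⟩, rfl⟩
    exact ⟨P v, hP v, rfl⟩
  · rintro _ ⟨Q, hQ, rfl⟩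
    have h1 : ∀ v ∈ AddSubmonoid.closure (t : Set (Fin k → ℕ)),
        ∃ c ∈ AddSubmonoid.closure (cls '' Set.range P), ∀ i, dimHom W c i = v i := by
      intro v hv
      induction hv using AddSubmonoid.closure_induction with
      | mem v hv =>
        exact ⟨cls (P ⟨v, hv⟩), AddSubmonoid.subset_closure ⟨_, ⟨_, rfl⟩, rfl⟩, hPv ⟨v, hv⟩⟩
      | zero => exact ⟨0, zero_mem _, fun i => by simp⟩
      | add v w _ _ hv hw =>
        obtain ⟨c, hc, hcv⟩ := hv
        obtain ⟨d, hd, hdw⟩ := hw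
        exact ⟨c + d, add_mem hc hd, fun i => by simp [hcv, hdw]⟩
    have hdim : ∀ i, dim W Q i = (dim W Q i).toNat := fun i =>
      (ENat.natCast_toNat (dim_ne_top W hA Q i)).symm
    have hQS : (fun i => (dim W Q i).toNat) ∈ AddSubmonoid.closure (t : Set (Fin k → ℕ)) := by
      rw [ht]
      exact ⟨Q, hQ, hdim⟩
    obtain ⟨c, hc, hcv⟩ := h1 _ hQS
    have : cls Q = c := dimHom_injective W hA (funext fun i => (hdim i).trans (hcv i).symm)
    rwa [this]

end semilocal

/-! ### Trace ideals -/

section trace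

variable {A : Type u} [Ring A]

theorem traceIdeal_smul_top (P : Type u) [AddCommGroup P] [Module A P] [Module.Projective A P] :
    (traceIdeal A P • ⊤ : Submodule A P) = ⊤ := by
  obtain ⟨i, hi⟩ := Module.projective_def'.mp (inferInstance : Module.Projective A P)
  rw [eq_top_iff]
  intro x _
  have hx : Finsupp.linearCombination A id (i x) = x := LinearMap.congr_fun hi x
  rw [← hx, Finsupp.linearCombination_apply]
  refine Submodule.sum_mem _ fun q _ => Submodule.smul_mem_smul ?_ Submodule.mem_top
  exact Submodule.mem_iSup_of_mem (Finsupp.lapply q ∘ₗ i) ⟨x, rfl⟩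

/-- The trace ideal of a projective module detects the simple quotients of the module. -/
theorem exists_ne_zero_iff_traceIdeal (P : Type u) [AddCommGroup P] [Module A P]
    [Module.Projective A P] (S : Type*) [AddCommGroup S] [Module A S] :
    (∃ f : P →ₗ[A] S, f ≠ 0) ↔ ∃ r ∈ traceIdeal A P, ∃ v : S, r • v ≠ 0 := by
  constructor
  · rintro ⟨f, hf⟩
    by_contra! h
    refine hf (LinearMap.ext fun x => ?_)
    have h1 : f x ∈ (traceIdeal A P • ⊤ : Submodule A S) :=
      map_mem_smul_top f _ ((traceIdeal_smul_top (A := A) P).ge Submodule.mem_top)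
    have h2 : (traceIdeal A P • ⊤ : Submodule A S) ≤ ⊥ :=
      Submodule.smul_le.mpr fun r hr v _ => h r hr v
    exact h2 h1
  · rintro ⟨r, hr, v, hv⟩
    by_contra! h
    have h1 : traceIdeal A P ≤ LinearMap.ker (LinearMap.toSpanSingleton A S v) := by
      refine iSup_le fun f => ?_
      rintro _ ⟨x, rfl⟩
      exact LinearMap.congr_fun (h (LinearMap.toSpanSingleton A S v ∘ₗ f)) x
    exact hv (h1 hr)

/-- If `I` does not annihilate any simple quotient of the projective module `P`, then `IP = P`:
otherwise `P ⧸ IP` is a nonzero projective `A ⧸ I`-module, so it has a simple quotient. -/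
theorem smul_top_eq_top (hA : IsSemisimpleRing (A ⧸ Ring.jacobson A)) {k : ℕ}
    (W : SimpleReps A k) (I : Ideal A) [I.IsTwoSided] (P : Type u) [AddCommGroup P] [Module A P]
    [Module.Projective A P]
    (h : ∀ i, (∃ f : P →ₗ[A] W.simple i, f ≠ 0) → ∃ r ∈ I, ∃ v : W.simple i, r • v ≠ 0) :
    (I • ⊤ : Submodule A P) = ⊤ := by
  have hproj := CGProj.projective_quotient P I
  let N : Submodule A P := I • ⊤ ⊔ Ring.jacobson A • ⊤
  have hN : N = ⊤ := by
    by_contra hN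
    have : Nontrivial (P ⧸ N) := Submodule.Quotient.nontrivial_iff.mpr hN
    have hss : IsSemisimpleModule A (P ⧸ N) :=
      isSemisimpleModule_of_jacobson_smul_eq_zero hA fun r hr x => by
        obtain ⟨x, rfl⟩ := Submodule.Quotient.mk_surjective _ x
        rw [← Submodule.Quotient.mk_smul, Submodule.Quotient.mk_eq_zero]
        exact Submodule.mem_sup_right (Submodule.smul_mem_smul hr Submodule.mem_top)
    obtain ⟨m, hm⟩ := IsSemisimpleModule.exists_simple_submodule A (P ⧸ N)
    obtain ⟨g, hg⟩ := IsSemisimpleModule.extension_property m.subtype m.injective_subtype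
      LinearMap.id
    obtain ⟨i, ⟨e⟩⟩ := W.exists_iso m hm
    have hgs : Function.Surjective g := fun x => ⟨x, LinearMap.congr_fun hg x⟩
    let f : P →ₗ[A] W.simple i := e.toLinearMap ∘ₗ g ∘ₗ N.mkQ
    have hf : Function.Surjective f := e.surjective.comp (hgs.comp N.mkQ_surjective)
    have hf0 : f ≠ 0 := by
      rintro h0
      obtain ⟨y, hy⟩ := @exists_ne _ (IsSimpleModule.nontrivial A (W.simple i)) 0
      obtain ⟨x, rfl⟩ := hf y
      exact hy (LinearMap.congr_fun h0 x)
    obtain ⟨r, hr, v, hv⟩ := h i ⟨f, hf0⟩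
    obtain ⟨x, rfl⟩ := hf v
    apply hv
    rw [← map_smul]
    have h1 : N.mkQ (r • x) = 0 := (Submodule.Quotient.mk_eq_zero N).mpr
      (Submodule.mem_sup_left (Submodule.smul_mem_smul hr Submodule.mem_top))
    simp only [f, LinearMap.comp_apply, h1, map_zero]
  have hJ : ∀ x ∈ (Ring.jacobson A • ⊤ : Submodule A P),
      (I • ⊤ : Submodule A P).mkQ x ∈ (Ring.jacobson (A ⧸ I) • ⊤ :
        Submodule (A ⧸ I) (P ⧸ (I • ⊤ : Submodule A P))) := by
    intro x hx
    induction hx using Submodule.smul_induction_on' with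
    | smul r hr y _ =>
      have h1 : Ideal.Quotient.mk I r ∈ Ring.jacobson (A ⧸ I) :=
        Ring.le_comap_jacobson (Ideal.Quotient.mk I) hr
      exact Submodule.smul_mem_smul (n := (I • ⊤ : Submodule A P).mkQ y) h1 Submodule.mem_top
    | add x _ y _ hx hy => rw [map_add]; exact add_mem hx hy
  have hsub : Subsingleton (P ⧸ (I • ⊤ : Submodule A P)) := by
    refine subsingleton_of_jacobson_smul_eq_top (A := A ⧸ I) ?_
    rw [Submodule.eq_top_iff']
    intro x
    obtain ⟨x, rfl⟩ := Submodule.mkQ_surjective _ x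
    have hx : x ∈ N := hN ▸ Submodule.mem_top
    obtain ⟨a, ha, b, hb, rfl⟩ := Submodule.mem_sup.mp hx
    have ha' : (I • ⊤ : Submodule A P).mkQ a = 0 := (Submodule.Quotient.mk_eq_zero _).mpr ha
    rw [map_add, ha', zero_add]
    exact hJ b hb
  rw [Submodule.eq_top_iff']
  exact fun x => (Submodule.Quotient.mk_eq_zero _).mp (Subsingleton.elim _ _)

theorem traceIdeal_le_of_smul_top_eq_top {I : Ideal A} [I.IsTwoSided] {P : Type u} [AddCommGroup P]
    [Module A P] (h : (I • ⊤ : Submodule A P) = ⊤) : traceIdeal A P ≤ I := by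
  refine iSup_le fun f => ?_
  rintro _ ⟨x, rfl⟩
  have h1 : f x ∈ (I • ⊤ : Submodule A A) := map_mem_smul_top f I (h.ge Submodule.mem_top)
  exact (Submodule.smul_le.mpr fun r hr v _ => Ideal.mul_mem_right v I hr :
    (I • ⊤ : Submodule A A) ≤ I) h1

variable {k : ℕ} (W : SimpleReps A k)

theorem mem_supp_dim_iff (hA : IsSemisimpleRing (A ⧸ Ring.jacobson A)) (P : Type u)
    [AddCommGroup P] [Module A P] [Module.Projective A P] (i : Fin k) :
    i ∈ supp (dim W P) ↔ ∃ r ∈ traceIdeal A P, ∃ v : W.simple i, r • v ≠ 0 :=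
  (dim_ne_zero_iff W hA P i).trans (exists_ne_zero_iff_traceIdeal P (W.simple i))

/-- If every simple quotient of `P` is one of `Q`, then the trace ideal of `Q` fixes `P`. -/
theorem traceIdeal_smul_top_eq_top (hA : IsSemisimpleRing (A ⧸ Ring.jacobson A)) {P Q : Type u}
    [AddCommGroup P] [Module A P] [Module.Projective A P] [AddCommGroup Q] [Module A Q]
    [Module.Projective A Q] (h : supp (dim W P) ⊆ supp (dim W Q)) :
    (traceIdeal A Q • ⊤ : Submodule A P) = ⊤ :=
  smul_top_eq_top hA W _ P fun i hi =>
    (mem_supp_dim_iff W hA Q i).mp (h ((dim_ne_zero_iff W hA P i).mpr hi))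

theorem traceIdeal_eq_iff (hA : IsSemisimpleRing (A ⧸ Ring.jacobson A)) {P Q : Type u}
    [AddCommGroup P] [Module A P] [Module.Projective A P] [AddCommGroup Q] [Module A Q]
    [Module.Projective A Q] :
    traceIdeal A P = traceIdeal A Q ↔ supp (dim W P) = supp (dim W Q) := by
  constructor
  · intro h
    ext i
    rw [mem_supp_dim_iff W hA, mem_supp_dim_iff W hA, h]
  · intro h
    exact le_antisymm
      (traceIdeal_le_of_smul_top_eq_top (traceIdeal_smul_top_eq_top W hA h.le))
      (traceIdeal_le_of_smul_top_eq_top (traceIdeal_smul_top_eq_top W hA h.ge))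

theorem exists_cls_eq (x : VStar A) : ∃ P : CGProj A, cls P = x := Quotient.exists_rep x

/-- Given finitely generated projective modules with one-element supports, every set is the support
of a finitely generated projective module. -/
theorem exists_supp_eq {p : Fin k → CGProj A}
    (hp : ∀ i, Module.Finite A (p i) ∧ supp (dim W (p i)) = {i}) (X : Set (Fin k)) :
    ∃ P : CGProj A, Module.Finite A P ∧ supp (dim W P) = X := by
  classical
  obtain ⟨P, hP⟩ := exists_cls_eq (∑ i ∈ X.toFinset, cls (p i))
  refine ⟨P, (mem_V_iff P).mp ?_, ?_⟩
  · rw [hP]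
    exact sum_mem fun i _ => (mem_V_iff _).mpr (hp i).1
  · ext j
    have hpj : ∀ i, dim W (p i) j ≠ 0 ↔ j = i := fun i => by
      change j ∈ supp (dim W (p i)) ↔ _
      rw [(hp i).2, Set.mem_singleton_iff]
    rw [supp, Set.mem_ofPred_eq, ← dimHom_cls, hP, map_sum, Finset.sum_apply, ne_eq,
      Finset.sum_eq_zero_iff]
    simp only [dimHom_cls, Set.mem_toFinset, not_forall]
    constructor
    · rintro ⟨i, hi, h⟩
      rwa [(hpj i).mp h]
    · intro hj
      exact ⟨j, hj, (hpj j).mpr rfl⟩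

/-- `Φ` is well defined, and it may be computed from any projective module with the given trace
ideal, countably generated or not. -/
theorem Phi_traceIdeal (hA : IsSemisimpleRing (A ⧸ Ring.jacobson A)) {p : Fin k → CGProj A}
    (hp : ∀ i, Module.Finite A (p i) ∧ supp (dim W (p i)) = {i}) (P : Type u) [AddCommGroup P]
    [Module A P] [Module.Projective A P] : Phi W (traceIdeal A P) = supp (dim W P) := by
  ext i
  constructor
  · rintro ⟨Q, hQ, hi⟩
    rwa [← (traceIdeal_eq_iff W hA).mp hQ]
  · intro hi
    obtain ⟨Q, -, hQ⟩ := exists_supp_eq W hp (supp (dim W P))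
    exact ⟨Q, (traceIdeal_eq_iff W hA).mpr hQ, hQ ▸ hi⟩

theorem bijOn_Phi (hA : IsSemisimpleRing (A ⧸ Ring.jacobson A)) {p : Fin k → CGProj A}
    (hp : ∀ i, Module.Finite A (p i) ∧ supp (dim W (p i)) = {i}) :
    Set.BijOn (Phi W) (traceIdeals A) Set.univ := by
  refine ⟨fun _ _ => Set.mem_univ _, ?_, ?_⟩
  · rintro _ ⟨P, _, _, hP, rfl⟩ _ ⟨Q, _, _, hQ, rfl⟩ h
    rw [Phi_traceIdeal W hA hp, Phi_traceIdeal W hA hp] at h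
    exact (traceIdeal_eq_iff W hA).mpr h
  · intro X _
    obtain ⟨P, -, hP⟩ := exists_supp_eq W hp X
    exact ⟨traceIdeal A P, ⟨P, _, _, P.proj, rfl⟩, (Phi_traceIdeal W hA hp P).trans hP⟩

end trace

/-! ### Lifting projective modules modulo a trace ideal -/

section lifting

variable {A : Type u} [Ring A]

/-- The map `1 - shift` whose cokernel is the mapping telescope `colim (T → T → ⋯)` of `φ`. -/
noncomputable def telescopeMap {T : Type*} [AddCommGroup T] [Module A T] (φ : T →ₗ[A] T) :
    (⨁ _ : ℕ, T) →ₗ[A] ⨁ _ : ℕ, T :=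
  DirectSum.toModule A ℕ _ fun n =>
    DirectSum.lof A ℕ (fun _ => T) n - DirectSum.lof A ℕ (fun _ => T) (n + 1) ∘ₗ φ

theorem telescopeMap_lof {T : Type*} [AddCommGroup T] [Module A T] (φ : T →ₗ[A] T) (n : ℕ) (t : T) :
    telescopeMap φ (DirectSum.lof A ℕ (fun _ => T) n t) =
      DirectSum.lof A ℕ (fun _ => T) n t - DirectSum.lof A ℕ (fun _ => T) (n + 1) (φ t) := by
  rw [telescopeMap, DirectSum.toModule_lof]
  rfl

/-- If `ψ` inverts `φ` on the range of `φ`, then the telescope of `φ` is a direct summand of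
`T ^ (ω)`. -/
theorem exists_leftInverse_telescopeMap {T : Type*} [AddCommGroup T] [Module A T]
    {φ ψ : T →ₗ[A] T} (h : ∀ t, ψ (φ (φ t)) = φ t) :
    ∃ σ : (⨁ _ : ℕ, T) →ₗ[A] ⨁ _ : ℕ, T, σ ∘ₗ telescopeMap φ = LinearMap.id := by
  let ι := DirectSum.lof A ℕ (fun _ => T)
  -- the recursion makes `g (n + 1) ∘ φ ∘ φ = g n ∘ φ - ι (n + 1) ∘ φ`
  let g : ℕ → T →ₗ[A] ⨁ _ : ℕ, T := fun n => Nat.rec 0 (fun n g => (g - ι (n + 1)) ∘ₗ ψ) n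
  refine ⟨DirectSum.toModule A ℕ _ fun n => ι n + g n ∘ₗ φ, DirectSum.linearMap_ext A fun n => ?_⟩
  ext1 t
  have hg : g (n + 1) (φ (φ t)) = g n (φ t) - ι (n + 1) (φ t) := by
    change (g n - ι (n + 1)) (ψ (φ (φ t))) = _
    rw [h, LinearMap.sub_apply]
  rw [LinearMap.comp_apply, LinearMap.comp_apply, telescopeMap_lof, map_sub,
    DirectSum.toModule_lof, DirectSum.toModule_lof]
  simp only [LinearMap.add_apply, LinearMap.comp_apply, hg, LinearMap.id_apply]
  change ι n t + g n (φ t) - _ = ι n t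
  abel

/-- If moreover `φ` induces modulo `I` a projection onto `N`, then the telescope `Q` of `φ` is a
countably generated projective module with `Q ⧸ IQ ≅ N`. -/
theorem exists_telescope (T : CGProj A) {φ ψ : T →ₗ[A] T} (h : ∀ t, ψ (φ (φ t)) = φ t)
    (I : Ideal A) {N : Type*} [AddCommGroup N] [Module A N] (hN : ∀ r ∈ I, ∀ n : N, r • n = 0)
    (pr : T →ₗ[A] N) (hpr : Function.Surjective pr) (hprφ : ∀ t, pr (φ t) = pr t)
    (hker : ∀ t, pr t = 0 → φ t ∈ (I • ⊤ : Submodule A T)) :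
    ∃ Q : CGProj A, Nonempty ((Q ⧸ (I • ⊤ : Submodule A Q)) ≃ₗ[A] N) := by
  let L := T.omega
  let ι : ℕ → T →ₗ[A] L := DirectSum.lof A ℕ (fun _ => (T : Type u))
  let D : L →ₗ[A] L := telescopeMap φ
  obtain ⟨σ, hσ⟩ : ∃ σ : L →ₗ[A] L, σ ∘ₗ D = LinearMap.id := exists_leftInverse_telescopeMap h
  let S := LinearMap.range D
  have hmk : ∀ n t, S.mkQ (ι n t) = S.mkQ (ι (n + 1) (φ t)) := fun n t => by
    rw [← sub_eq_zero, ← map_sub]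
    exact (Submodule.Quotient.mk_eq_zero S).mpr ⟨ι n t, telescopeMap_lof φ n t⟩
  have hproj : Module.Projective A (L ⧸ S) := by
    refine Module.Projective.of_split (S.liftQ (LinearMap.id - D ∘ₗ σ) ?_) S.mkQ ?_
    · rintro _ ⟨x, rfl⟩
      have := LinearMap.congr_fun hσ x
      simp only [LinearMap.comp_apply, LinearMap.id_apply] at this
      rw [LinearMap.mem_ker, LinearMap.sub_apply, LinearMap.comp_apply, this, LinearMap.id_apply,
        sub_self]
    · refine Submodule.linearMap_qext S (LinearMap.ext fun x => ?_)
      have h1 : S.mkQ (D (σ x)) = 0 := (Submodule.Quotient.mk_eq_zero S).mpr ⟨σ x, rfl⟩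
      have h2 : S.mkQ (x - D (σ x)) = S.mkQ x := by rw [map_sub, h1, sub_zero]
      exact h2
  let Q : CGProj A :=
    { carrier := L ⧸ S
      countablyGenerated := quotient_countablyGenerated L.countablyGenerated S }
  let ρ : L →ₗ[A] N := DirectSum.toModule A ℕ N fun _ => pr
  have hρ : ∀ n t, ρ (ι n t) = pr t := fun n t => DirectSum.toModule_lof ..
  have hρD : ρ ∘ₗ D = 0 := DirectSum.linearMap_ext A fun n => LinearMap.ext fun t => by
    have h1 : D (ι n t) = ι n t - ι (n + 1) (φ t) := telescopeMap_lof φ n t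
    change ρ (D (ι n t)) = 0
    rw [h1, map_sub, hρ, hρ, hprφ, sub_self]
  let q : (L ⧸ S) →ₗ[A] N := S.liftQ ρ (by
    rintro _ ⟨x, rfl⟩
    exact LinearMap.congr_fun hρD x)
  have hq : ∀ x, q (S.mkQ x) = ρ x := fun x => S.liftQ_apply ρ x
  have hqs : Function.Surjective q := fun y => by
    obtain ⟨t, rfl⟩ := hpr y
    exact ⟨S.mkQ (ι 0 t), (hq _).trans (hρ 0 t)⟩
  -- every element of the telescope comes from all sufficiently late stages
  have hstage : ∀ x : L, ∃ K, ∀ l ≥ K, ∃ t, S.mkQ x = S.mkQ (ι l t) := by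
    intro x
    induction x using DirectSum.induction_on with
    | zero => exact ⟨0, fun l _ => ⟨0, by rw [map_zero]; rfl⟩⟩
    | of n t =>
      refine ⟨n, fun l hl => ?_⟩
      induction l, hl using Nat.le_induction with
      | base => exact ⟨t, rfl⟩
      | succ l _ ih =>
        obtain ⟨t', ht'⟩ := ih
        exact ⟨φ t', ht'.trans (hmk l t')⟩
    | add x y hx hy =>
      obtain ⟨K, hK⟩ := hx
      obtain ⟨K', hK'⟩ := hy
      refine ⟨max K K', fun l hl => ?_⟩
      obtain ⟨t, ht⟩ := hK l (le_trans (le_max_left _ _) hl)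
      obtain ⟨t', ht'⟩ := hK' l (le_trans (le_max_right _ _) hl)
      exact ⟨t + t', ((map_add S.mkQ x y).trans (congrArg₂ _ ht ht')).trans
        (by rw [map_add (ι l), map_add S.mkQ])⟩
  have hkerq : (I • ⊤ : Submodule A (L ⧸ S)) = LinearMap.ker q := by
    apply le_antisymm
    · rw [Submodule.smul_le]
      intro r hr x _
      rw [LinearMap.mem_ker, map_smul, hN r hr]
    · intro x hx
      obtain ⟨x, rfl⟩ := S.mkQ_surjective x
      obtain ⟨K, hK⟩ := hstage x
      obtain ⟨t, ht⟩ := hK K le_rfl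
      rw [LinearMap.mem_ker, ht, hq, hρ] at hx
      rw [ht, hmk]
      exact map_mem_smul_top (S.mkQ ∘ₗ ι (K + 1)) I (hker t hx)
  exact ⟨Q, ⟨(Submodule.quotEquivOfEq _ _ hkerq).trans (q.quotKerEquivOfSurjective hqs)⟩⟩

theorem directSum_smul_top_eq_top {ι : Type*} {P : Type*} [AddCommGroup P] [Module A P]
    {I : Ideal A} (h : (I • ⊤ : Submodule A P) = ⊤) :
    (I • ⊤ : Submodule A (⨁ _ : ι, P)) = ⊤ := by
  classical
  rw [Submodule.eq_top_iff']
  intro x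
  induction x using DirectSum.induction_on with
  | zero => exact zero_mem _
  | of i x => exact map_mem_smul_top (DirectSum.lof A ι (fun _ => P) i) I (h.ge Submodule.mem_top)
  | add x y hx hy => exact add_mem hx hy

/-- A homomorphism from a finitely generated free module to itself with image in `IF`, where `I` is
contained in the trace ideal of `P`, factors through `P ^ (ω)`. -/
theorem exists_factorization {F P : Type u} [AddCommGroup F] [Module A F] [Module.Finite A F]
    [Module.Projective A F] [AddCommGroup P] [Module A P] {I : Ideal A} (hI : I ≤ traceIdeal A P)
    (f : F →ₗ[A] F) (hf : ∀ x, f x ∈ (I • ⊤ : Submodule A F)) :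
    ∃ (a : F →ₗ[A] ⨁ _ : ℕ, P) (b : (⨁ _ : ℕ, P) →ₗ[A] F), b ∘ₗ a = f := by
  have h1 : (I • ⊤ : Submodule A F) ≤ ⨆ g : P →ₗ[A] F, LinearMap.range g := by
    rw [Submodule.smul_le]
    intro r hr x _
    have h2 : traceIdeal A P ≤ Submodule.comap (LinearMap.toSpanSingleton A F x)
        (⨆ g : P →ₗ[A] F, LinearMap.range g) := by
      refine iSup_le fun g => ?_
      rintro _ ⟨y, rfl⟩
      exact Submodule.mem_iSup_of_mem (LinearMap.toSpanSingleton A F x ∘ₗ g) ⟨y, rfl⟩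
    exact h2 (hI hr)
  have h3 : LinearMap.range f ≤ ⨆ g : P →ₗ[A] F, LinearMap.range g := by
    rintro _ ⟨x, rfl⟩
    exact h1 (hf x)
  have hfg : (LinearMap.range f).FG := by
    rw [LinearMap.range_eq_map]
    exact Module.Finite.fg_top.map f
  obtain ⟨s, hs⟩ := CompleteLattice.IsCompactElement.exists_finset_of_le_iSup _
    ((Submodule.fg_iff_compact _).mp hfg) _ h3
  obtain ⟨g, hg⟩ := (s.countable_toSet.insert 0).exists_eq_range (Set.insert_nonempty 0 _)
  let b : (⨁ _ : ℕ, P) →ₗ[A] F := DirectSum.toModule A ℕ F g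
  have hb : LinearMap.range f ≤ LinearMap.range b := by
    refine hs.trans (iSup₂_le fun j hj => ?_)
    obtain ⟨n, hn⟩ : j ∈ Set.range g := hg ▸ Set.mem_insert_of_mem 0 hj
    rintro _ ⟨x, rfl⟩
    exact ⟨DirectSum.lof A ℕ (fun _ => P) n x, by rw [DirectSum.toModule_lof, hn]⟩
  obtain ⟨a, ha⟩ := Module.projective_lifting_property b.rangeRestrict
    (f.codRestrict (LinearMap.range b) fun x => hb ⟨x, rfl⟩) b.surjective_rangeRestrict
  exact ⟨a, b, LinearMap.ext fun x => congrArg Subtype.val (LinearMap.congr_fun ha x)⟩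

/-- If an endomorphism `E` of a finitely generated projective module `F` induces modulo `I` a
projection onto `N`, then `N` lifts to a countably generated projective module.

The map `E` itself is in general not invertible on its range. But `E - E ^ 3 = b ∘ a` factors through
`P' = P ^ (ω)`, and `F × P' ^ (ω)` agrees with `F` modulo `I`. Recording `a x` in a new coordinate,
`φ (x, y) = (E x, (a x, y₀, y₁, …))`, keeps the information that is needed to undo `φ` on its range,
by `ψ (x, y) = (E x + b y₁, (y₁, y₂, …))`. -/
theorem exists_lift_of_idempotent_mod (F P : CGProj A) [Module.Finite A F] (I : Ideal A)
    (hI : I ≤ traceIdeal A P) (hP : (I • ⊤ : Submodule A P) = ⊤)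
    {N : Type*} [AddCommGroup N] [Module A N] (hN : ∀ r ∈ I, ∀ n : N, r • n = 0)
    (pr : F →ₗ[A] N) (hpr : Function.Surjective pr) (E : F →ₗ[A] F) (hE : ∀ x, pr (E x) = pr x)
    (hker : ∀ x, pr x = 0 → E x ∈ (I • ⊤ : Submodule A F)) :
    ∃ Q : CGProj A, Nonempty ((Q ⧸ (I • ⊤ : Submodule A Q)) ≃ₗ[A] N) := by
  obtain ⟨a, b, hab⟩ : ∃ (a : F →ₗ[A] P.omega) (b : P.omega →ₗ[A] F),
      b ∘ₗ a = E - E ∘ₗ E ∘ₗ E := exists_factorization hI _ (fun x => by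
    have := hker (x - E (E x)) (by rw [map_sub, hE, hE, sub_self])
    rwa [map_sub] at this)
  have hab' : ∀ x, b (a x) = E x - E (E (E x)) := fun x => LinearMap.congr_fun hab x
  let P' := P.omega
  let T := F.add P'.omega
  let ι : ℕ → P' →ₗ[A] P'.omega := DirectSum.lof A ℕ (fun _ => (P' : Type u))
  let shift : P'.omega →ₗ[A] P'.omega := DirectSum.toModule A ℕ _ fun n => ι (n + 1)
  let unshift : P'.omega →ₗ[A] P'.omega :=
    DirectSum.toModule A ℕ _ fun n => Nat.casesOn n 0 fun n => ι n
  let c : ℕ → P'.omega →ₗ[A] P' := DirectSum.component A ℕ (fun _ => (P' : Type u))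
  have hshift : ∀ n x, shift (ι n x) = ι (n + 1) x := fun n x => DirectSum.toModule_lof ..
  have hunshift : ∀ n x, unshift (ι (n + 1) x) = ι n x := fun n x => DirectSum.toModule_lof ..
  have hunshift0 : ∀ x, unshift (ι 0 x) = 0 := fun x => DirectSum.toModule_lof ..
  have hus : ∀ x, unshift (shift x) = x := fun x => by
    have : unshift ∘ₗ shift = LinearMap.id := DirectSum.linearMap_ext A fun n =>
      LinearMap.ext fun x => (congrArg unshift (hshift n x)).trans (hunshift n x)
    exact LinearMap.congr_fun this x
  have hcι : ∀ n x, c n (ι n x) = x := fun n x => DirectSum.component.lof_self ..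
  have hcι' : ∀ m n x, m ≠ n → c n (ι m x) = 0 := fun m n x h => by
    change DirectSum.component A ℕ (fun _ => (P' : Type u)) n (DirectSum.lof A ℕ _ m x) = 0
    rw [DirectSum.component.of, dif_neg h]
  have hcss : ∀ x, c 1 (shift (shift x)) = 0 := fun x => by
    have : c 1 ∘ₗ shift ∘ₗ shift = 0 := DirectSum.linearMap_ext A fun n =>
      LinearMap.ext fun x => by
        change c 1 (shift (shift (ι n x))) = 0
        rw [hshift, hshift, hcι' _ _ _ (by omega)]
    exact LinearMap.congr_fun this x
  let φ : T →ₗ[A] T := LinearMap.prod (E ∘ₗ LinearMap.fst A F P'.omega)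
    (ι 0 ∘ₗ a ∘ₗ LinearMap.fst A F P'.omega + shift ∘ₗ LinearMap.snd A F P'.omega)
  let ψ : T →ₗ[A] T := LinearMap.prod
    (E ∘ₗ LinearMap.fst A F P'.omega + b ∘ₗ c 1 ∘ₗ LinearMap.snd A F P'.omega)
    (unshift ∘ₗ LinearMap.snd A F P'.omega)
  have hφ : ∀ (x : F) (y : P'.omega), φ (x, y) = (E x, ι 0 (a x) + shift y) := fun _ _ => rfl
  have hψ : ∀ (x : F) (y : P'.omega), ψ (x, y) = (E x + b (c 1 y), unshift y) := fun _ _ => rfl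
  refine exists_telescope T (φ := φ) (ψ := ψ) ?_ I hN (pr ∘ₗ LinearMap.fst A F P'.omega)
    (hpr.comp Prod.fst_surjective) ?_ ?_
  · rintro ⟨x, y⟩
    rw [hφ, hφ, hψ, map_add shift, hshift, map_add (c 1), map_add (c 1), hcss, hcι,
      hcι' 0 1 _ (by omega), map_add unshift, map_add unshift, hunshift, hunshift0, hus, zero_add,
      zero_add, add_zero, hab', add_sub_cancel]
  · rintro ⟨x, y⟩
    exact hE x
  · rintro ⟨x, y⟩ hx
    have hT : (I • ⊤ : Submodule A P'.omega) = ⊤ :=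
      directSum_smul_top_eq_top (directSum_smul_top_eq_top hP)
    have h1 : φ (x, y) ∈ (I • ⊤ : Submodule A F).prod (I • ⊤ : Submodule A P'.omega) :=
      ⟨hker x hx, hT.ge Submodule.mem_top⟩
    rwa [← smul_top_prod] at h1

/-- A map between `A ⧸ I`-modules that is linear over `A` is linear over `A ⧸ I`. -/
def toQuotientLinear (I : Ideal A) [I.IsTwoSided] {M N : Type*} [AddCommGroup M] [Module A M]
    [Module (A ⧸ I) M] [AddCommGroup N] [Module A N] [Module (A ⧸ I) N]
    (hM : ∀ (r : A) (x : M), Ideal.Quotient.mk I r • x = r • x)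
    (hN : ∀ (r : A) (x : N), Ideal.Quotient.mk I r • x = r • x) (f : M →ₗ[A] N) :
    M →ₗ[A ⧸ I] N where
  toFun := f
  map_add' := f.map_add
  map_smul' r x := by
    obtain ⟨r, rfl⟩ := Ideal.Quotient.mk_surjective r
    rw [hM, f.map_smul, RingHom.id_apply, hN]

/-- An isomorphism over `A` between `A ⧸ I`-modules is an isomorphism over `A ⧸ I`. -/
def toQuotientLinearEquiv (I : Ideal A) [I.IsTwoSided] {M N : Type*} [AddCommGroup M] [Module A M]
    [Module (A ⧸ I) M] [AddCommGroup N] [Module A N] [Module (A ⧸ I) N]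
    (hM : ∀ (r : A) (x : M), Ideal.Quotient.mk I r • x = r • x)
    (hN : ∀ (r : A) (x : N), Ideal.Quotient.mk I r • x = r • x) (e : M ≃ₗ[A] N) :
    M ≃ₗ[A ⧸ I] N :=
  { toQuotientLinear I hM hN e.toLinearMap, e.toEquiv with }

/-- Finitely generated projective modules over the quotient by the trace ideal `I` of a countably
generated projective module lift to countably generated projective modules (Herbera–Příhoda). -/
theorem exists_modIdeal_eq (P : CGProj A) (I : Ideal A) [I.IsTwoSided] (hI : traceIdeal A P = I)
    (N : CGProj (A ⧸ I)) [Module.Finite (A ⧸ I) N] :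
    ∃ Q : CGProj A, cls (Q.modIdeal I) = cls N := by
  let _ : Module A N := Module.compHom N (Ideal.Quotient.mk I)
  have hNs : ∀ (r : A) (x : N), Ideal.Quotient.mk I r • x = r • x := fun _ _ => rfl
  have hN0 : ∀ r ∈ I, ∀ n : N, r • n = 0 := fun r hr n => by
    rw [← hNs, Ideal.Quotient.eq_zero_iff_mem.mpr hr, zero_smul]
  have hNfin : Module.Finite A N := by
    obtain ⟨s, hs⟩ := Module.Finite.fg_top (R := A ⧸ I) (M := N)
    refine ⟨⟨s, (Submodule.eq_top_iff').mpr fun x => ?_⟩⟩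
    have hx : x ∈ Submodule.span (A ⧸ I) (s : Set N) := hs ▸ Submodule.mem_top
    induction hx using Submodule.span_induction with
    | mem x hx => exact Submodule.subset_span hx
    | zero => exact Submodule.zero_mem _
    | add x y _ _ hx hy => exact Submodule.add_mem _ hx hy
    | smul r x _ hx =>
      obtain ⟨r, rfl⟩ := Ideal.Quotient.mk_surjective r
      exact Submodule.smul_mem _ r hx
  obtain ⟨n, pr, hpr⟩ := Module.Finite.exists_fin' A N
  let F : CGProj A :=
    { carrier := Fin n → A
      countablyGenerated := countablyGenerated_of_finite _ }
  have hF : Module.Finite A F := inferInstanceAs (Module.Finite A (Fin n → A))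
  let IF : Submodule A F := I • ⊤
  have hker : IF ≤ LinearMap.ker pr := by
    rw [Submodule.smul_le]
    intro r hr x _
    rw [LinearMap.mem_ker, map_smul, hN0 r hr]
  let q : F.modIdeal I →ₗ[A ⧸ I] N :=
    toQuotientLinear I (M := F ⧸ IF) (fun _ _ => rfl) hNs (IF.liftQ pr hker)
  have hq : ∀ x : F, q (IF.mkQ x) = pr x := fun _ => rfl
  have hqs : Function.Surjective q := fun y => by
    obtain ⟨x, rfl⟩ := hpr y
    exact ⟨IF.mkQ x, hq x⟩
  obtain ⟨s, hs⟩ := Module.projective_lifting_property q LinearMap.id hqs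
  let s' : N →ₗ[A] F ⧸ IF :=
    { toFun := s
      map_add' := s.map_add
      map_smul' := fun r x => s.map_smul (Ideal.Quotient.mk I r) x }
  obtain ⟨E, hE⟩ := Module.projective_lifting_property IF.mkQ (s' ∘ₗ pr) IF.mkQ_surjective
  have hE' : ∀ x, IF.mkQ (E x) = s (pr x) := fun x => LinearMap.congr_fun hE x
  obtain ⟨Q, ⟨e⟩⟩ := exists_lift_of_idempotent_mod F P I hI.ge
    (hI ▸ traceIdeal_smul_top (A := A) P) hN0 pr hpr E
    (fun x => by rw [← hq, hE']; exact LinearMap.congr_fun hs (pr x))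
    (fun x hx => (Submodule.Quotient.mk_eq_zero IF).mp
      ((hE' x).trans ((congrArg s hx).trans s.map_zero)))
  exact ⟨Q, Quotient.sound ⟨toQuotientLinearEquiv I (M := Q ⧸ (I • ⊤ : Submodule A Q))
    (fun _ _ => rfl) hNs e⟩⟩

end lifting

/-! ### Decomposition of countably generated projective modules -/

section decomposition

variable {A : Type u} [Ring A]

/-- Reduction modulo a two-sided ideal `I` as a homomorphism `V*(A) → V*(A ⧸ I)`. -/
noncomputable def modHom (I : Ideal A) [I.IsTwoSided] : VStar A →+ VStar (A ⧸ I) where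
  toFun := Quotient.map (fun P => P.modIdeal I) fun P Q ⟨e⟩ =>
    ⟨toQuotientLinearEquiv I (M := P ⧸ (I • ⊤ : Submodule A P))
      (N := Q ⧸ (I • ⊤ : Submodule A Q)) (fun _ _ => rfl) (fun _ _ => rfl) (quotSMulCongr I e)⟩
  map_zero' := by
    have h1 : Subsingleton ((CGProj.zero A).modIdeal I) := inferInstanceAs
      (Subsingleton (PUnit.{u + 1} ⧸ (I • ⊤ : Submodule A PUnit.{u + 1})))
    have h2 : Subsingleton (CGProj.zero (A ⧸ I)) := inferInstanceAs (Subsingleton PUnit)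
    exact Quotient.sound ⟨0⟩
  map_add' := by
    rintro ⟨P⟩ ⟨Q⟩
    exact Quotient.sound ⟨toQuotientLinearEquiv I
      (M := (P × Q) ⧸ (I • ⊤ : Submodule A (P × Q)))
      (N := (P ⧸ (I • ⊤ : Submodule A P)) × (Q ⧸ (I • ⊤ : Submodule A Q)))
      (fun _ _ => rfl) (fun _ _ => rfl) (quotSMulProdEquiv P Q I)⟩

theorem modHom_cls (I : Ideal A) [I.IsTwoSided] (P : CGProj A) :
    modHom I (cls P) = cls (P.modIdeal I) := rfl

theorem modHom_cls_eq_zero {I : Ideal A} [I.IsTwoSided] {P : CGProj A}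
    (h : (I • ⊤ : Submodule A P) = ⊤) : modHom I (cls P) = 0 := by
  have h1 : Subsingleton (P.modIdeal I) := by
    refine subsingleton_of_forall_eq 0 fun x => ?_
    obtain ⟨x, rfl⟩ := Submodule.Quotient.mk_surjective (I • ⊤ : Submodule A P) x
    exact (Submodule.Quotient.mk_eq_zero _).mpr (h.ge Submodule.mem_top)
  have h2 : Subsingleton (CGProj.zero (A ⧸ I)) := inferInstanceAs (Subsingleton PUnit)
  exact Quotient.sound ⟨0⟩

theorem modHom_cls_mem_V (I : Ideal A) [I.IsTwoSided] (P : CGProj A) [hP : Module.Finite A P] :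
    modHom I (cls P) ∈ V (A ⧸ I) := by
  rw [modHom_cls, mem_V_iff]
  obtain ⟨s, hs⟩ := hP.fg_top
  classical
  refine ⟨⟨s.image (I • ⊤ : Submodule A P).mkQ, (Submodule.eq_top_iff').mpr fun x => ?_⟩⟩
  obtain ⟨x, rfl⟩ := Submodule.Quotient.mk_surjective (I • ⊤ : Submodule A P) x
  have hx : x ∈ Submodule.span A (s : Set P) := hs ▸ Submodule.mem_top
  induction hx using Submodule.span_induction with
  | mem x hx => exact Submodule.subset_span (Finset.mem_coe.mpr (Finset.mem_image_of_mem _ hx))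
  | zero => exact Submodule.zero_mem _
  | add x y _ _ hx hy => exact Submodule.add_mem _ hx hy
  | smul r x _ hx => exact Submodule.smul_mem _ (Ideal.Quotient.mk I r) hx

variable {k : ℕ} (W : SimpleReps A k)

theorem dimHom_le_of_modHom_eq (hA : IsSemisimpleRing (A ⧸ Ring.jacobson A)) {I : Ideal A}
    [I.IsTwoSided] {i : Fin k} (hi : ∀ r ∈ I, ∀ v : W.simple i, r • v = 0) {x y : VStar A}
    (h : modHom I x = modHom I y) : dimHom W x i ≤ dimHom W y i := by
  obtain ⟨P, rfl⟩ := exists_cls_eq x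
  obtain ⟨Q, rfl⟩ := exists_cls_eq y
  obtain ⟨e⟩ : Nonempty (P.modIdeal I ≃ₗ[A ⧸ I] Q.modIdeal I) := Quotient.exact h
  let IP : Submodule A P := I • ⊤
  let IQ : Submodule A Q := I • ⊤
  let e' : (Q ⧸ IQ) →ₗ[A] P ⧸ IP :=
    { toFun := e.symm
      map_add' := e.symm.map_add
      map_smul' := fun r x => e.symm.map_smul (Ideal.Quotient.mk I r) x }
  rw [dimHom_cls, dimHom_cls, ← ENat.forall_natCast_le_iff_le]
  intro n hn
  rw [le_dim_iff W hA] at hn ⊢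
  obtain ⟨f, hf⟩ := hn
  have hker : IP ≤ LinearMap.ker f := by
    rw [Submodule.smul_le]
    intro r hr x _
    rw [LinearMap.mem_ker, map_smul]
    exact funext fun a => hi r hr _
  let g := IP.liftQ f hker
  have hg : Function.Surjective g := fun y => by
    obtain ⟨x, rfl⟩ := hf y
    exact ⟨IP.mkQ x, rfl⟩
  exact ⟨g ∘ₗ e' ∘ₗ IQ.mkQ, hg.comp (e.symm.surjective.comp IQ.mkQ_surjective)⟩

/-- The multiplicity of a simple `A ⧸ I`-module in `P` depends only on `P ⧸ IP`. -/
theorem dimHom_eq_of_modHom_eq (hA : IsSemisimpleRing (A ⧸ Ring.jacobson A)) {I : Ideal A}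
    [I.IsTwoSided] {i : Fin k} (hi : ∀ r ∈ I, ∀ v : W.simple i, r • v = 0) {x y : VStar A}
    (h : modHom I x = modHom I y) : dimHom W x i = dimHom W y i :=
  le_antisymm (dimHom_le_of_modHom_eq W hA hi h) (dimHom_le_of_modHom_eq W hA hi h.symm)

theorem dim_omega_eq_top (hA : IsSemisimpleRing (A ⧸ Ring.jacobson A)) (P : CGProj A) {i : Fin k}
    (hi : dim W P i ≠ 0) : dim W P.omega i = ⊤ := by
  obtain ⟨f, hf⟩ := (dim_ne_zero_iff W hA P i).mp hi
  have hfs := LinearMap.surjective_of_ne_zero hf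
  rw [eq_top_iff, ← ENat.forall_natCast_le_iff_le]
  intro n _
  rw [le_dim_iff W hA]
  let g : (⨁ _ : ℕ, (P : Type u)) →ₗ[A] (Fin n → W.simple i) :=
    LinearMap.pi fun a => f ∘ₗ DirectSum.component A ℕ (fun _ => (P : Type u)) a
  have hg : Function.Surjective g := fun y => by
    choose x hx using fun a => hfs (y a)
    refine ⟨∑ a : Fin n, DirectSum.lof A ℕ (fun _ => (P : Type u)) a (x a), ?_⟩
    funext b
    simp only [g, LinearMap.pi_apply, LinearMap.comp_apply, map_sum]
    rw [Finset.sum_eq_single b]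
    · rw [DirectSum.component.lof_self, hx]
    · intro a _ hab
      rw [DirectSum.component.of, dif_neg fun h => hab (Fin.ext h), map_zero]
    · simp
  exact ⟨g, hg⟩

theorem dim_omega_eq_zero (hA : IsSemisimpleRing (A ⧸ Ring.jacobson A)) (P : CGProj A) {i : Fin k}
    (hi : dim W P i = 0) : dim W P.omega i = 0 := by
  by_contra h
  obtain ⟨f, hf⟩ := (dim_ne_zero_iff W hA P.omega i).mp h
  refine hf (DirectSum.linearMap_ext A fun n => ?_)
  by_contra hn
  exact (dim_ne_zero_iff W hA P i).mpr ⟨_, hn⟩ hi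

variable {p : Fin k → CGProj A}

open Classical in
theorem dimHom_sum_omega (hA : IsSemisimpleRing (A ⧸ Ring.jacobson A))
    (hp : ∀ i, Module.Finite A (p i) ∧ supp (dim W (p i)) = {i}) (X : Finset (Fin k)) (i : Fin k) :
    dimHom W (∑ j ∈ X, cls (p j).omega) i = if i ∈ X then ⊤ else 0 := by
  have h1 : ∀ j, dim W (p j).omega i = if i = j then ⊤ else 0 := by
    intro j
    split_ifs with h
    · exact dim_omega_eq_top W hA _ ((hp j).2.ge h)
    · exact dim_omega_eq_zero W hA _ (not_not.mp fun h' => h ((hp j).2.le h'))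
  simp only [map_sum, Finset.sum_apply, dimHom_cls, h1, Finset.sum_ite_eq]

/-- If `I (p i) = p i` whenever the `i`-th multiplicity of `P` is infinite, then `P ⧸ IP` is finitely
generated: some multiple of the class of `P` is a sum of classes of modules `p j ^ (ω)` that
vanish modulo `I` and of finitely many `p j`. -/
theorem modHom_cls_mem_V_of_infSupp (hA : IsSemisimpleRing (A ⧸ Ring.jacobson A))
    (hp : ∀ i, Module.Finite A (p i) ∧ supp (dim W (p i)) = {i}) (P : CGProj A) (I : Ideal A)
    [I.IsTwoSided] (hI : ∀ i ∈ infSupp (dim W P), (I • ⊤ : Submodule A (p i)) = ⊤) :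
    modHom I (cls P) ∈ V (A ⧸ I) := by
  classical
  let X := (infSupp (dim W P)).toFinset
  have hX : ∀ i, i ∈ X ↔ dim W P i = ⊤ := fun i => Set.mem_toFinset (s := infSupp (dim W P))
  let d : Fin k → ℕ := fun j => (dim W (p j) j).toNat
  have hd : ∀ j, dim W (p j) j = d j := fun j => by
    have := (hp j).1
    exact (ENat.natCast_toNat (dim_ne_top W hA (p j) j)).symm
  have hpd : ∀ i j, dim W (p j) i = if i = j then (d j : ℕ∞) else 0 := by
    intro i j
    split_ifs with h
    · rw [h, hd]
    · exact not_not.mp fun h' => h ((hp j).2.le h')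
  have hd0 : ∀ j, d j ≠ 0 := fun j h => by
    have h1 : dim W (p j) j ≠ 0 := (hp j).2.ge rfl
    rw [hd, h] at h1
    exact h1 rfl
  -- a multiple of `P` whose finite multiplicities are divisible by those of the `p j`
  let n := ∏ j, d j
  have hn : n ≠ 0 := Finset.prod_ne_zero_iff.mpr fun j _ => hd0 j
  have hdn : ∀ j, n / d j * d j = n := fun j =>
    Nat.div_mul_cancel (Finset.dvd_prod_of_mem d (Finset.mem_univ j))
  let m : Fin k → ℕ := fun j => (dim W P j).toNat
  have key : n • cls P = ∑ j ∈ X, cls (p j).omega + ∑ j ∈ Xᶜ, (m j * (n / d j)) • cls (p j) := by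
    apply dimHom_injective W hA
    funext i
    rw [map_add, Pi.add_apply, dimHom_sum_omega W hA hp]
    simp only [map_sum, map_nsmul, Finset.sum_apply, Pi.smul_apply, dimHom_cls, hpd, smul_ite,
      smul_zero, Finset.sum_ite_eq, Finset.mem_compl]
    simp only [nsmul_eq_mul]
    by_cases hi : i ∈ X
    · have hi' : dim W P i = ⊤ := (hX i).mp hi
      rw [if_pos hi, hi', top_add]
      exact ENat.mul_top (Nat.cast_ne_zero.mpr hn)
    · have hi' : dim W P i = m i := (ENat.natCast_toNat fun h => hi ((hX i).mpr h)).symm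
      rw [if_neg hi, if_pos hi, zero_add, hi', ← Nat.cast_mul, ← Nat.cast_mul, mul_assoc, hdn,
        mul_comm]
  have h1 : n • modHom I (cls P) ∈ V (A ⧸ I) := by
    rw [← map_nsmul, key, map_add, map_sum, map_sum]
    refine add_mem (sum_mem fun j hj => ?_) (sum_mem fun j _ => ?_)
    · rw [modHom_cls_eq_zero (directSum_smul_top_eq_top (hI j ((hX j).mp hj)))]
      exact zero_mem _
    · have := (hp j).1
      rw [map_nsmul]
      exact nsmul_mem (modHom_cls_mem_V I (p j)) _
  obtain ⟨n', hn'⟩ := Nat.exists_eq_succ_of_ne_zero hn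
  rw [hn', succ_nsmul'] at h1
  exact mem_V_of_add_mem h1

/-- The class of `P` is the sum of the classes of the `p i ^ (ω)` for the infinite multiplicities
and of a combination of given lifts of generators of `V(A ⧸ I)`. -/
theorem exists_cls_eq_sum_omega_add (hA : IsSemisimpleRing (A ⧸ Ring.jacobson A))
    (hp : ∀ i, Module.Finite A (p i) ∧ supp (dim W (p i)) = {i}) (P : CGProj A)
    [Fintype (infSupp (dim W P))] (I : Ideal A) [I.IsTwoSided] (hIT : I ∈ traceIdeals A)
    (hI : Phi W I = infSupp (dim W P))
    (G : Set (CGProj A))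
    (hG : AddSubmonoid.closure ((fun Q => cls (Q.modIdeal I)) '' G) = V (A ⧸ I)) :
    ∃ c ∈ AddSubmonoid.closure (cls '' G),
      cls P = ∑ i : infSupp (dim W P), cls (p i).omega + c := by
  classical
  obtain ⟨Q, _, _, hQ, rfl⟩ := hIT
  rw [Phi_traceIdeal W hA hp] at hI
  have hV : modHom (traceIdeal A Q) (cls P) ∈ V (A ⧸ traceIdeal A Q) :=
    modHom_cls_mem_V_of_infSupp W hA hp P _ fun i hi =>
      traceIdeal_smul_top_eq_top W hA (by rw [(hp i).2, hI, Set.singleton_subset_iff]; exact hi)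
  have himage : (fun Q' : CGProj A => cls (Q'.modIdeal (traceIdeal A Q))) '' G =
      modHom (traceIdeal A Q) '' (cls '' G) := by
    rw [Set.image_image]
    rfl
  rw [← hG, himage, ← AddMonoidHom.map_mclosure] at hV
  obtain ⟨c, hc, hcP⟩ := hV
  refine ⟨c, hc, dimHom_injective W hA (funext fun i => ?_)⟩
  have hsum : ∑ j : infSupp (dim W P), cls (p j).omega =
      ∑ j ∈ (infSupp (dim W P)).toFinset, cls (p j).omega :=
    Finset.sum_set_coe (f := fun j => cls (p j).omega) (infSupp (dim W P))
  rw [map_add, Pi.add_apply, hsum, dimHom_sum_omega W hA hp]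
  split_ifs with hi
  · rw [top_add]
    exact (Set.mem_toFinset (s := infSupp (dim W P))).mp hi
  · rw [zero_add]
    refine dimHom_eq_of_modHom_eq W hA (I := traceIdeal A Q) ?_ hcP.symm
    by_contra! h
    exact hi ((Set.mem_toFinset (s := infSupp (dim W P))).mpr
      (hI.le ((mem_supp_dim_iff W hA Q i).mpr h)))

/-- A module whose class is a finite sum of classes is the corresponding direct sum. -/
theorem nonempty_equiv_directSum {ι : Type*} [Fintype ι] [DecidableEq ι] (f : ι → CGProj A)
    (P : CGProj A) (h : cls P = ∑ i, cls (f i)) : Nonempty (P ≃ₗ[A] ⨁ i, (f i : Type u)) := by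
  have key : ∀ (n : ℕ) (f : Fin n → CGProj A) (P : CGProj A), cls P = ∑ i, cls (f i) →
      Nonempty (P ≃ₗ[A] ∀ i, (f i : Type u)) := by
    intro n
    induction n with
    | zero =>
      intro f P h
      rw [Fin.sum_univ_zero] at h
      obtain ⟨e⟩ : Nonempty (P ≃ₗ[A] PUnit.{u + 1}) := Quotient.exact h
      have : Subsingleton P := e.toEquiv.subsingleton
      exact ⟨0⟩
    | succ n ih =>
      intro f P h
      obtain ⟨Q, hQ⟩ := exists_cls_eq (∑ i : Fin n, cls (f i.succ))
      rw [Fin.sum_univ_succ, ← hQ] at h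
      obtain ⟨e⟩ : Nonempty (P ≃ₗ[A] f 0 × Q) := Quotient.exact h
      obtain ⟨e'⟩ := ih _ Q hQ
      exact ⟨e.trans (((LinearEquiv.refl A (f 0)).prodCongr e').trans
        (Fin.consLinearEquiv A fun i => (f i : Type u)))⟩
  let e := Fintype.equivFin ι
  obtain ⟨E⟩ := key _ (fun i => f (e.symm i)) P
    (h.trans (Equiv.sum_comp e.symm fun i => cls (f i)).symm)
  exact ⟨(E.trans (DirectSum.linearEquivFunOnFintype A _ _).symm).trans
    (DirectSum.lequivCongrLeft A (M := fun i => (f i : Type u)) e).symm⟩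

theorem exists_sum_of_mem_closure {G : Set (CGProj A)} [Fintype G] {c : VStar A}
    (hc : c ∈ AddSubmonoid.closure (cls '' G)) : ∃ n : G → ℕ, c = ∑ Q : G, n Q • cls Q.1 := by
  classical
  induction hc using AddSubmonoid.closure_induction with
  | mem x hx =>
    obtain ⟨Q, hQ, rfl⟩ := hx
    refine ⟨Pi.single ⟨Q, hQ⟩ 1, ?_⟩
    rw [Finset.sum_eq_single ⟨Q, hQ⟩]
    · simp
    · intro Q' _ h
      rw [Pi.single_eq_of_ne h, zero_nsmul]
    · simp
  | zero => exact ⟨0, by simp⟩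
  | add x y _ _ hx hy =>
    obtain ⟨n, rfl⟩ := hx
    obtain ⟨m, rfl⟩ := hy
    exact ⟨n + m, by simp [add_nsmul, Finset.sum_add_distrib]⟩

theorem nonempty_equiv_of_cls_eq {ι : Type*} [Fintype ι] [DecidableEq ι] (f : ι → CGProj A)
    {G : Set (CGProj A)} [Fintype G] (n : G → ℕ) (P : CGProj A)
    (h : cls P = ∑ i, cls (f i) + ∑ Q : G, n Q • cls Q.1) :
    Nonempty (P ≃ₗ[A] (⨁ i, (f i : Type u)) × ⨁ Q : G, ⨁ _ : Fin (n Q), (Q.1 : Type u)) := by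
  classical
  obtain ⟨M, hM⟩ := exists_cls_eq (∑ i, cls (f i))
  obtain ⟨N, hN⟩ := exists_cls_eq (∑ Q : G, n Q • cls Q.1)
  choose D hD using fun Q : G => exists_cls_eq (n Q • cls Q.1)
  have hDe : ∀ Q : G, Nonempty (D Q ≃ₗ[A] ⨁ _ : Fin (n Q), (Q.1 : Type u)) := fun Q =>
    nonempty_equiv_directSum (fun _ => Q.1) _ (by simp [hD])
  obtain ⟨e⟩ : Nonempty (P ≃ₗ[A] M × N) := Quotient.exact (h.trans (by rw [← hM, ← hN]; rfl))
  obtain ⟨e₁⟩ := nonempty_equiv_directSum f M hM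
  obtain ⟨e₂⟩ := nonempty_equiv_directSum D N (by simp only [hD, hN])
  exact ⟨e.trans (e₁.prodCongr (e₂.trans
    (DFinsupp.mapRange.linearEquiv fun Q => (hDe Q).some)))⟩

end decomposition

/-! ### Semi-semiperfect rings -/

section semisemiperfect

/-- An element of the Jacobson radical of `R` lies in the Jacobson radical of the opposite ring. -/
theorem op_mem_jacobson {R : Type*} [Ring R] {x : R} (hx : x ∈ Ring.jacobson R) :
    MulOpposite.op x ∈ Ring.jacobson Rᵐᵒᵖ := by
  -- `1 + y` is left invertible for `y ∈ J(R)`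
  have hleft : ∀ y ∈ Ring.jacobson R, ∃ u, u * (1 + y) = 1 := by
    intro y hy
    by_contra! h
    obtain ⟨m, hm, hle⟩ := Ideal.exists_le_maximal (Ideal.span {1 + y}) (by
      rw [Ideal.ne_top_iff_one, Ideal.mem_span_singleton']
      rintro ⟨u, hu⟩
      exact h u hu)
    refine hm.ne_top ((Ideal.eq_top_iff_one m).mpr ?_)
    have h1 := sub_mem (hle (Ideal.mem_span_singleton_self _)) (Ring.jacobson_le_of_isMaximal m hy)
    rwa [add_sub_cancel_right] at h1
  -- hence `1 + y` is invertible
  have hunit : ∀ y ∈ Ring.jacobson R, IsUnit (1 + y) := by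
    intro y hy
    obtain ⟨u, hu⟩ := hleft y hy
    obtain ⟨v, hv⟩ := hleft (-(u * y)) (neg_mem (Ideal.mul_mem_left _ u hy))
    have hu' : 1 + -(u * y) = u := by rw [← hu, mul_add, mul_one, add_neg_cancel_right]
    rw [hu'] at hv
    have hvu : v = 1 + y := by
      calc v = v * (u * (1 + y)) := by rw [hu, mul_one]
        _ = 1 + y := by rw [← mul_assoc, hv, one_mul]
    exact ⟨⟨1 + y, u, hvu ▸ hv, hu⟩, rfl⟩
  rw [Ring.jacobson_eq_sInf_isMaximal, Ideal.mem_sInf]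
  intro m hm
  by_contra hxm
  obtain ⟨r, hr⟩ := hm.exists_inv hxm
  obtain ⟨y, hym, hy⟩ := hr
  have h1 : y = MulOpposite.op (1 + -(x * r.unop)) := by
    rw [← MulOpposite.unop_inj]
    have := congrArg MulOpposite.unop hy
    simp only [MulOpposite.unop_add, MulOpposite.unop_mul, MulOpposite.unop_op,
      MulOpposite.unop_one] at this
    rw [MulOpposite.unop_op, ← this]
    abel
  refine hm.ne_top (Ideal.eq_top_of_isUnit_mem m hym ?_)
  rw [h1]
  exact (hunit _ (neg_mem (Ideal.mul_mem_right _ _ hx))).op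

theorem isSemisimpleRing_mulOpposite_quotient_jacobson {R : Type*} [Ring R]
    (h : IsSemisimpleRing (R ⧸ Ring.jacobson R)) :
    IsSemisimpleRing (Rᵐᵒᵖ ⧸ Ring.jacobson Rᵐᵒᵖ) := by
  let f : Rᵐᵒᵖ →+* (R ⧸ Ring.jacobson R)ᵐᵒᵖ := (Ideal.Quotient.mk (Ring.jacobson R)).op
  have hf : Function.Surjective f := fun y => by
    obtain ⟨x, hx⟩ := Ideal.Quotient.mk_surjective y.unop
    exact ⟨MulOpposite.op x, MulOpposite.unop_injective hx⟩
  have hker : RingHom.ker f = Ring.jacobson Rᵐᵒᵖ := by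
    apply le_antisymm
    · intro x hx
      have h1 : Ideal.Quotient.mk (Ring.jacobson R) x.unop = 0 := MulOpposite.op_injective hx
      exact op_mem_jacobson (Ideal.Quotient.eq_zero_iff_mem.mp h1)
    · have : RingHomSurjective f := ⟨hf⟩
      have h1 := Ring.le_comap_jacobson f
      rwa [IsSemisimpleRing.jacobson_eq_bot (R ⧸ Ring.jacobson R)ᵐᵒᵖ] at h1
  exact ((Ideal.quotEquivOfEq hker.symm).trans
    (RingHom.quotientKerEquivOfSurjective hf)).symm.isSemisimpleRing

theorem supp_dim_eq_singleton {A : Type u} [Ring A] {k : ℕ} (W : SimpleReps A k)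
    (hA : IsSemisimpleRing (A ⧸ Ring.jacobson A)) {P : Type u} [AddCommGroup P] [Module A P]
    {n : ℕ} (hn : 1 ≤ n) {i : Fin k}
    (e : (P ⧸ (Ring.jacobson A • ⊤ : Submodule A P)) ≃ₗ[A] (Fin n → W.simple i)) :
    supp (dim W P) = {i} := by
  ext j
  rw [Set.mem_singleton_iff]
  refine (dim_ne_zero_iff W hA P j).trans ⟨?_, ?_⟩
  · rintro ⟨f, hf⟩
    let g := (Ring.jacobson A • ⊤ : Submodule A P).liftQ f (jacobson_smul_top_le_ker f) ∘ₗ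
      e.symm.toLinearMap
    obtain ⟨a, ha⟩ : ∃ a, g ∘ₗ LinearMap.single A (fun _ => W.simple i) a ≠ 0 := by
      by_contra! h
      have hg : g = 0 := LinearMap.pi_ext' fun a => by rw [h a, LinearMap.zero_comp]
      refine hf (LinearMap.ext fun x => ?_)
      have h1 := LinearMap.congr_fun hg (e (Submodule.Quotient.mk x))
      simpa [g] using h1
    exact (W.eq_of_iso i j ⟨.ofBijective _
      ((LinearMap.bijective_or_eq_zero _).resolve_right ha)⟩).symm
  · rintro rfl
    have := IsSimpleModule.nontrivial A (W.simple j)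
    obtain ⟨y, hy⟩ := exists_ne (0 : W.simple j)
    obtain ⟨x, hx⟩ := Submodule.mkQ_surjective _ (e.symm fun _ => y)
    refine ⟨LinearMap.proj ⟨0, hn⟩ ∘ₗ e.toLinearMap ∘ₗ Submodule.mkQ _, fun h => hy ?_⟩
    have h1 := LinearMap.congr_fun h x
    rw [LinearMap.comp_apply, LinearMap.comp_apply, hx] at h1
    simpa using h1

/-- Generators of `V(A ⧸ I)` lift to countably generated projective modules. -/
theorem exists_finite_lifts {A : Type u} [Ring A] (hA : IsSemisimpleRing (A ⧸ Ring.jacobson A))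
    (P : CGProj A) (I : Ideal A) [I.IsTwoSided] (hI : traceIdeal A P = I) :
    ∃ G : Set (CGProj A), G.Finite ∧
      AddSubmonoid.closure ((fun Q => cls (Q.modIdeal I)) '' G) = V (A ⧸ I) := by
  have hAI : IsSemisimpleRing ((A ⧸ I) ⧸ Ring.jacobson (A ⧸ I)) := by
    have hle : Ring.jacobson A ≤ (Ring.jacobson (A ⧸ I)).comap (Ideal.Quotient.mk I) :=
      Ring.le_comap_jacobson (Ideal.Quotient.mk I)
    exact RingHom.isSemisimpleRing_of_surjective
      (Ideal.quotientMap _ (Ideal.Quotient.mk I) hle)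
      (Ideal.quotientMap_surjective Ideal.Quotient.mk_surjective)
  obtain ⟨s, hs, hsf, hsV⟩ := exists_finite_closure_eq_V hAI
  have hlift : ∀ N : s, ∃ Q : CGProj A, cls (Q.modIdeal I) = cls N.1 := fun N => by
    have := hsf N.1 N.2
    exact exists_modIdeal_eq P I hI N.1
  choose Q hQ using hlift
  have := hs.to_subtype
  refine ⟨Set.range Q, Set.finite_range Q, ?_⟩
  rw [← hsV, ← Set.range_comp]
  congr 1
  ext x
  constructor
  · rintro ⟨N, rfl⟩
    exact ⟨N.1, N.2, (hQ N).symm⟩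
  · rintro ⟨N, hN, rfl⟩
    exact ⟨⟨N, hN⟩, hQ ⟨N, hN⟩⟩

theorem isTwoSided_of_mem_traceIdeals {A : Type u} [Ring A] {I : Ideal A}
    (hI : I ∈ traceIdeals A) : I.IsTwoSided := by
  obtain ⟨P, _, _, _, rfl⟩ := hI
  infer_instance

variable {A : Type u} [Ring A] {k : ℕ} (W : SimpleReps A k) {p : Fin k → CGProj A}

theorem exists_family_of_lifts (hA : IsSemisimpleRing (A ⧸ Ring.jacobson A))
    (hp : ∀ i, Module.Finite A (p i) ∧ supp (dim W (p i)) = {i}) :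
    ∃ G : Ideal A → Set (CGProj A), ∀ (J : Ideal A) [J.IsTwoSided], J ∈ traceIdeals A →
      (G J).Finite ∧
        AddSubmonoid.closure ((fun Q => cls (Q.modIdeal J)) '' G J) = V (A ⧸ J) := by
  have h : ∀ J : Ideal A, ∃ G : Set (CGProj A), ∀ [J.IsTwoSided], J ∈ traceIdeals A →
      G.Finite ∧ AddSubmonoid.closure ((fun Q => cls (Q.modIdeal J)) '' G) = V (A ⧸ J) := by
    intro J
    by_cases hJ : J ∈ traceIdeals A
    · have := isTwoSided_of_mem_traceIdeals hJ
      obtain ⟨P, _, _, hP, hPJ⟩ := hJ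
      -- `J` is also the trace ideal of a countably generated projective module
      obtain ⟨Q, -, hQ⟩ := exists_supp_eq W hp (supp (dim W P))
      obtain ⟨G, hG, hGV⟩ :=
        exists_finite_lifts hA Q J (((traceIdeal_eq_iff W hA).mpr hQ).trans hPJ)
      exact ⟨G, fun _ => ⟨hG, hGV⟩⟩
    · exact ⟨∅, fun h => absurd h hJ⟩
  choose G hG using h
  exact ⟨G, fun J _ hJ => hG J hJ⟩

/-- The decomposition of a countably generated projective module into copies of the `p i ^ (ω)` and
of given lifts of generators of `V(A ⧸ I)`. -/
theorem exists_nonempty_equiv (hA : IsSemisimpleRing (A ⧸ Ring.jacobson A))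
    (hp : ∀ i, Module.Finite A (p i) ∧ supp (dim W (p i)) = {i}) (P : CGProj A) {I : Ideal A}
    [I.IsTwoSided] (hIT : I ∈ traceIdeals A) (hI : Phi W I = infSupp (dim W P))
    {G : Set (CGProj A)} (hG : G.Finite ∧
      AddSubmonoid.closure ((fun Q => cls (Q.modIdeal I)) '' G) = V (A ⧸ I)) :
    ∃ n : G → ℕ, Nonempty (P ≃ₗ[A] (⨁ i : infSupp (dim W P), ⨁ _ : ℕ, (p i : Type u)) ×
      ⨁ Q : G, ⨁ _ : Fin (n Q), (Q.1 : Type u)) := by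
  classical
  have := hG.1.fintype
  obtain ⟨c, hc, hPc⟩ := exists_cls_eq_sum_omega_add W hA hp P I hIT hI G hG.2
  obtain ⟨n, rfl⟩ := exists_sum_of_mem_closure hc
  exact ⟨n, nonempty_equiv_of_cls_eq (fun i : infSupp (dim W P) => (p i).omega) n P hPc⟩

theorem closure_omega_union_eq_top (hA : IsSemisimpleRing (A ⧸ Ring.jacobson A))
    (hp : ∀ i, Module.Finite A (p i) ∧ supp (dim W (p i)) = {i}) {G : Ideal A → Set (CGProj A)}
    (hG : ∀ (J : Ideal A) [J.IsTwoSided], J ∈ traceIdeals A →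
      AddSubmonoid.closure ((fun Q => cls (Q.modIdeal J)) '' G J) = V (A ⧸ J)) :
    AddSubmonoid.closure (Set.range (fun i => cls (p i).omega) ∪
      ⋃ J ∈ traceIdeals A, cls '' G J) = ⊤ := by
  classical
  rw [eq_top_iff]
  intro x _
  obtain ⟨P, rfl⟩ := exists_cls_eq x
  obtain ⟨I, hIT, hI⟩ := (bijOn_Phi W hA hp).surjOn (Set.mem_univ (infSupp (dim W P)))
  have := isTwoSided_of_mem_traceIdeals hIT
  obtain ⟨c, hc, hPc⟩ := exists_cls_eq_sum_omega_add W hA hp P I hIT hI (G I) (hG I hIT)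
  rw [hPc]
  refine add_mem (sum_mem fun i _ => AddSubmonoid.subset_closure (Or.inl ⟨i, rfl⟩))
    (AddSubmonoid.closure_mono ?_ hc)
  exact Set.subset_union_of_subset_right
    (Set.subset_biUnion_of_mem (u := fun J => cls '' G J) hIT) _

end semisemiperfect

end SemiSemi

open SemiSemi in
theorem theorem4p5 (R : Type u) [Ring R] (hR : IsSemiSemiperfect R) :
    -- there are only finitely many simple right modules up to isomorphism
    (∃ k : ℕ, Nonempty (SimpleReps Rᵐᵒᵖ k)) ∧
    (∀ (k : ℕ) (W : SimpleReps Rᵐᵒᵖ k),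
      -- trace ideals correspond to the subsets of `{1, …, k}`
      Set.BijOn (Phi W) (traceIdeals Rᵐᵒᵖ) Set.univ ∧
      -- modules `P_1, …, P_k` and finite sets `G_J` as below exist
      (∃ p : Fin k → CGProj Rᵐᵒᵖ,
        ∀ i, Module.Finite Rᵐᵒᵖ (p i) ∧ Phi W (traceIdeal Rᵐᵒᵖ (p i)) = {i}) ∧
      (∃ G : Ideal Rᵐᵒᵖ → Set (CGProj Rᵐᵒᵖ),
        ∀ (J : Ideal Rᵐᵒᵖ) [J.IsTwoSided], J ∈ traceIdeals Rᵐᵒᵖ →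
          (G J).Finite ∧
          AddSubmonoid.closure ((fun Q => cls (Q.modIdeal J)) '' G J) = V (Rᵐᵒᵖ ⧸ J)) ∧
      -- for every choice of them, the decomposition and the generation statement hold
      (∀ (p : Fin k → CGProj Rᵐᵒᵖ) (G : Ideal Rᵐᵒᵖ → Set (CGProj Rᵐᵒᵖ)),
        (∀ i, Module.Finite Rᵐᵒᵖ (p i) ∧ Phi W (traceIdeal Rᵐᵒᵖ (p i)) = {i}) →
        (∀ (J : Ideal Rᵐᵒᵖ) [J.IsTwoSided], J ∈ traceIdeals Rᵐᵒᵖ →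
          (G J).Finite ∧
          AddSubmonoid.closure ((fun Q => cls (Q.modIdeal J)) '' G J) = V (Rᵐᵒᵖ ⧸ J)) →
        (∀ (P : CGProj Rᵐᵒᵖ) (I : Ideal Rᵐᵒᵖ), I ∈ traceIdeals Rᵐᵒᵖ →
          Phi W I = infSupp (dim W P) →
          ∃ n : G I → ℕ, Nonempty (P ≃ₗ[Rᵐᵒᵖ]
            (⨁ i : infSupp (dim W P), ⨁ _ : ℕ, p i) ×
              (⨁ Q : G I, ⨁ _ : Fin (n Q), (Q : CGProj Rᵐᵒᵖ)))) ∧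
        (Set.range (fun i => cls (p i).omega) ∪
            ⋃ J ∈ traceIdeals Rᵐᵒᵖ, cls '' G J).Finite ∧
        AddSubmonoid.closure (Set.range (fun i => cls (p i).omega) ∪
            ⋃ J ∈ traceIdeals Rᵐᵒᵖ, cls '' G J) = ⊤)) ∧
    -- in particular `V*(R)` is finitely generated
    AddMonoid.FG (VStar Rᵐᵒᵖ) := by
  have hA := isSemisimpleRing_mulOpposite_quotient_jacobson hR.semilocal
  have hreps := exists_simpleReps hA
  refine ⟨hreps, (and_iff_left_of_imp ?_).mpr fun k W => ?_⟩
  · intro h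
    obtain ⟨k, ⟨W⟩⟩ := hreps
    obtain ⟨-, ⟨p, hp⟩, ⟨G, hG⟩, h⟩ := h k W
    obtain ⟨-, hfin, hgen⟩ := h p G hp hG
    exact ⟨⟨hfin.toFinset, by rw [hfin.coe_toFinset, hgen]⟩⟩
  · have hp₀ : ∀ i, ∃ P : CGProj Rᵐᵒᵖ, Module.Finite Rᵐᵒᵖ P ∧ supp (dim W P) = {i} := fun i => by
      obtain ⟨n, hn, P, hP, ⟨e⟩⟩ := hR.exists_projective (W.simple i) (W.isSimple i)
      exact ⟨P, hP, supp_dim_eq_singleton W hA hn e⟩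
    choose p₀ hp₀ using hp₀
    have hbij := bijOn_Phi W hA hp₀
    refine ⟨hbij, ⟨p₀, fun i => ⟨(hp₀ i).1, ?_⟩⟩, exists_family_of_lifts W hA hp₀, ?_⟩
    · rw [Phi_traceIdeal W hA hp₀, (hp₀ i).2]
    · intro p G hp hG
      have hp' : ∀ i, Module.Finite Rᵐᵒᵖ (p i) ∧ supp (dim W (p i)) = {i} := fun i =>
        ⟨(hp i).1, by rw [← Phi_traceIdeal W hA hp₀, (hp i).2]⟩
      refine ⟨fun P I hI hIX => ?_, ?_, closure_omega_union_eq_top W hA hp' fun J _ hJ =>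
        (hG J hJ).2⟩
      · have := isTwoSided_of_mem_traceIdeals hI
        exact exists_nonempty_equiv W hA hp' P hI hIX (hG I hI)
      · have hT : (traceIdeals Rᵐᵒᵖ).Finite :=
          Set.Finite.of_injOn hbij.mapsTo hbij.injOn Set.finite_univ
        exact (Set.finite_range _).union (hT.biUnion fun J hJ =>
          ((@hG J (isTwoSided_of_mem_traceIdeals hJ) hJ).1.image cls))
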